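/- Let $n\ge 2$ and let $(F^n,g)$ be a smooth ($C^\infty$) Riemannian manifold without boundary (Hausdorff and second countable; orientability is not needed). Let $N^{n-1}\subset F$ be a smoothly embedded hypersurface which separates $F$ into two sides: $F\setminus N=F_+\cup F_-$ with $F_+,F_-$ open and disjoint, and let $\nu$ be the unit normal of $N$ for which, along all of $N$, $\nu$ points into $F_+$ and $-\nu$ points into $F_-$. Write $\Delta$ for the Laplace–Beltrami operator $\operatorname{div}\operatorname{grad}$ and $\operatorname{scal}$ for the scalar curvature of $(F,g)$. Let $f_1,f_2>0$ be smooth functions on $F$ with $$-\Delta f_i+\frac{n-2}{4(n-1)}\,\operatorname{scal}\cdot f_i>0\ \text{ on } F\quad(i=1,2),\qquad f_1=f_2\ \text{ and }\ \frac{\partial f_1}{\partial \nu}>\frac{\partial f_2}{\partial \nu}\ \text{ on } N .$$ Then each $p\in N$ has a neighborhood $U$ in $F$ with $f_2<f_1$ on $U\cap F_+$ and $f_1<f_2$ on $U\cap F_-$ (so near $N$ the smaller function is $f_2$ on the side $F_+$ and $f_1$ on the side $F_-$), and for every neighborhood $E$ of $N$ in $F$ there is a smooth function $f_E>0$ on $F$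 with $$-\Delta f_E+\frac{n-2}{4(n-1)}\,\operatorname{scal}\cdot f_E>0\ \text{ on } F,\qquad f_E=f_2\ \text{ on } F_+\setminus E,\qquad f_E=f_1\ \text{ on } F_-\setminus E .$$ -/

import Mathlib

open Set Filter Topology
open scoped Manifold ContDiff

noncomputable section

namespace ConformalSmoothing

/-- A smooth Riemannian metric on a smooth `n`-manifold `F` (without boundary). -/
abbrev SmoothMetric (n : ℕ) (F : Type*) [TopologicalSpace F]
    [ChartedSpace (EuclideanSpace ℝ (Fin n)) F] [IsManifold (𝓡 n) ∞ F] :=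
  Bundle.ContMDiffRiemannianMetric (𝓡 n) ∞ (EuclideanSpace ℝ (Fin n))
    (fun x : F => TangentSpace (𝓡 n) x)

/-- The `i`-th partial derivative at `y` of a real function on `ℝⁿ`. -/
def pderiv {n : ℕ} (i : Fin n) (h : EuclideanSpace ℝ (Fin n) → ℝ)
    (y : EuclideanSpace ℝ (Fin n)) : ℝ :=
  fderiv ℝ h y (EuclideanSpace.single i 1)

section Coordinates

variable {n : ℕ} {F : Type*} [TopologicalSpace F]
  [ChartedSpace (EuclideanSpace ℝ (Fin n)) F]

/-- The tangent vector `v` at `p` points into `S`: it is the velocity at time `0` of a curve that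
starts at `p` and runs in `S` for small positive times. -/
def PointsInto (p : F) (v : TangentSpace (𝓡 n) p) (S : Set F) : Prop :=
  ∃ γ : ℝ → F, γ 0 = p ∧
    HasMFDerivAt 𝓘(ℝ, ℝ) (𝓡 n) γ 0 ((1 : ℝ →L[ℝ] ℝ).smulRight (v : EuclideanSpace ℝ (Fin n))) ∧
    ∀ᶠ t in 𝓝[>] (0 : ℝ), γ t ∈ S

/-- The derivative `∂f/∂v` of a real function `f` at `p` in the direction of a tangent vector. -/
def dirDeriv (f : F → ℝ) (p : F) (v : TangentSpace (𝓡 n) p) : ℝ :=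
  mfderiv (𝓡 n) 𝓘(ℝ, ℝ) f p v

/-- The coordinate vector `∂ᵢ` of the chart `e`, at the point with coordinates `y`. -/
def coordVec (e : OpenPartialHomeomorph F (EuclideanSpace ℝ (Fin n)))
    (y : EuclideanSpace ℝ (Fin n)) (i : Fin n) : TangentSpace (𝓡 n) (e.symm y) :=
  mfderiv (𝓡 n) (𝓡 n) e.symm y (EuclideanSpace.single i (1 : ℝ))

variable [IsManifold (𝓡 n) ∞ F] (g : SmoothMetric n F)
  (e : OpenPartialHomeomorph F (EuclideanSpace ℝ (Fin n)))

/-- The coefficients `gᵢⱼ = g(∂ᵢ, ∂ⱼ)` of the metric in the chart `e`. -/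
def metricMatrix (y : EuclideanSpace ℝ (Fin n)) : Matrix (Fin n) (Fin n) ℝ :=
  Matrix.of fun i j => g.inner (e.symm y) (coordVec e y i) (coordVec e y j)

/-- The coefficients `gⁱʲ` of the inverse matrix. -/
def invMetric (i j : Fin n) (y : EuclideanSpace ℝ (Fin n)) : ℝ :=
  (metricMatrix g e y)⁻¹ i j

/-- Christoffel symbols `Γᵏᵢⱼ = ½ ∑ₗ gᵏˡ (∂ᵢ gⱼₗ + ∂ⱼ gᵢₗ - ∂ₗ gᵢⱼ)`. -/
def christoffel (k i j : Fin n) (y : EuclideanSpace ℝ (Fin n)) : ℝ :=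
  (1 / 2) * ∑ l, invMetric g e k l y *
    (pderiv i (fun z => metricMatrix g e z j l) y
      + pderiv j (fun z => metricMatrix g e z i l) y
      - pderiv l (fun z => metricMatrix g e z i j) y)

/-- Coefficients `Rˡₖᵢⱼ` of the curvature tensor, defined by
`R(∂ᵢ, ∂ⱼ) ∂ₖ = ∇ᵢ ∇ⱼ ∂ₖ - ∇ⱼ ∇ᵢ ∂ₖ = ∑ₗ Rˡₖᵢⱼ ∂ₗ`. -/
def riemann (l k i j : Fin n) (y : EuclideanSpace ℝ (Fin n)) : ℝ :=
  pderiv i (christoffel g e l j k) y - pderiv j (christoffel g e l i k) y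
    + ∑ m, (christoffel g e l i m y * christoffel g e m j k y
      - christoffel g e l j m y * christoffel g e m i k y)

/-- Ricci curvature `Ricⱼₖ = ∑ᵢ Rⁱₖᵢⱼ` (the trace of `X ↦ R(X, ∂ⱼ) ∂ₖ`). -/
def ricci (j k : Fin n) (y : EuclideanSpace ℝ (Fin n)) : ℝ :=
  ∑ i, riemann g e i k i j y

/-- Scalar curvature `∑ gʲᵏ Ricⱼₖ` in the chart `e`. -/
def scalInChart (y : EuclideanSpace ℝ (Fin n)) : ℝ :=
  ∑ j, ∑ k, invMetric g e j k y * ricci g e j k y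

/-- The Laplacian `∑ gⁱʲ (∂ᵢ ∂ⱼ f - ∑ₖ Γᵏᵢⱼ ∂ₖ f)` (the trace of the Hessian) in the chart `e`. -/
def laplacianInChart (f : F → ℝ) (y : EuclideanSpace ℝ (Fin n)) : ℝ :=
  ∑ i, ∑ j, invMetric g e i j y *
    (pderiv i (pderiv j (f ∘ e.symm)) y
      - ∑ k, christoffel g e k i j y * pderiv k (f ∘ e.symm) y)

end Coordinates

section Global

variable {n : ℕ} {F : Type*} [TopologicalSpace F]
  [ChartedSpace (EuclideanSpace ℝ (Fin n)) F] [IsManifold (𝓡 n) ∞ F] (g : SmoothMetric n F)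

/-- Scalar curvature of `(F, g)`. It does not depend on the chart used to compute it; the preferred
chart at the point is used. -/
def scal (x : F) : ℝ :=
  scalInChart g (chartAt (EuclideanSpace ℝ (Fin n)) x) (chartAt (EuclideanSpace ℝ (Fin n)) x x)

/-- Laplace-Beltrami operator `Δ f = div grad f` of `(F, g)` (negative semidefinite sign). It does
not depend on the chart used to compute it; the preferred chart at the point is used. -/
def laplacian (f : F → ℝ) (x : F) : ℝ :=
  laplacianInChart g (chartAt (EuclideanSpace ℝ (Fin n)) x) f
    (chartAt (EuclideanSpace ℝ (Fin n)) x x)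

/-- The conformal Laplacian `-Δ f + (n - 2) / (4 (n - 1)) · scal · f`. -/
def conformalLaplacian (f : F → ℝ) (x : F) : ℝ :=
  -laplacian g f x + ((n : ℝ) - 2) / (4 * ((n : ℝ) - 1)) * scal g x * f x

/-- The vector `v` at `ι x` is a unit normal vector of the hypersurface `ι : N → F` at `x`. -/
def IsUnitNormal {N : Type*} [TopologicalSpace N]
    [ChartedSpace (EuclideanSpace ℝ (Fin (n - 1))) N] (ι : N → F) (x : N)
    (v : TangentSpace (𝓡 n) (ι x)) : Prop :=
  g.inner (ι x) v v = 1 ∧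
    ∀ w : TangentSpace (𝓡 (n - 1)) x, g.inner (ι x) v (mfderiv (𝓡 (n - 1)) (𝓡 n) ι x w) = 0

end Global

end ConformalSmoothing

end

/-! Write `f₁ = f₂ (1 + r)`. Then `r` vanishes on the hypersurface with positive normal derivative,
so it is positive near it on `P` and negative on `M`. Near the hypersurface the function wanted is a
smoothing of `min f₁ f₂ = f₂ (1 + min r 0)`. The kink of a minimum of two strict supersolutions is
concave, and so is a favourable singularity; the point is to smooth it without losing positivity.

The smoothing is `f₂ (1 + δ η(r/δ))`, where `η` is a smooth concave function equal to `min s 0` for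
`|s| ≥ 1`, and `δ > 0` is a small smooth function. It equals `f₂` where `r ≥ δ` and `f₁` where `r ≤
-δ`. A variable `δ` is needed because the hypersurface need not be compact. With `s = r/δ`, `w =
η'`, `b = -η''` and `Z = s w - η`, `conformalLaplacian_glue` writes its conformal Laplacian as a
combination of those of `f₂` and `f₁`, plus the good term `f₂ δ b |∇s|²`, plus an error `Z (f₂ Δδ +
2⟨∇f₂, ∇δ⟩)`. The profile of `exists_smooth_concave_min` satisfies `0 ≤ Z ≤ b` and `Z ≤ 1 - w`: the
first lets the good term absorb the error even where `b` degenerates, the second keeps the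
combination nonnegative.

`exists_small_smooth_pos` supplies a `δ` whose derivatives are small compared with `|∇r|²`,
`exists_nhds_sign_of_pointsInto` matches the sign of `r` with the two sides, and `exists_glued`
pastes. Scalar curvature enters only as the coefficient of a zeroth-order term in a pointwise
identity. The Laplacian must be continuous in the point, hence the proof that it does not depend on
the chart. -/

noncomputable section

namespace ConformalSmoothing

set_option linter.unusedSectionVars false

/-! ### The metric in a chart: positivity and smoothness. -/

section

variable {n : ℕ} {F : Type*} [TopologicalSpace F]
  [ChartedSpace (EuclideanSpace ℝ (Fin n)) F] [IsManifold (𝓡 n) ∞ F]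

/-- The metric in the chart `e`, as a bilinear form on `ℝⁿ` depending on the point. -/
def chartMetric (g : SmoothMetric n F)
    (e : OpenPartialHomeomorph F (EuclideanSpace ℝ (Fin n))) (y : EuclideanSpace ℝ (Fin n)) :
    EuclideanSpace ℝ (Fin n) →L[ℝ] EuclideanSpace ℝ (Fin n) →L[ℝ] ℝ :=
  let G : EuclideanSpace ℝ (Fin n) →L[ℝ] EuclideanSpace ℝ (Fin n) →L[ℝ] ℝ := g.inner (e.symm y)
  let D : EuclideanSpace ℝ (Fin n) →L[ℝ] EuclideanSpace ℝ (Fin n) :=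
    mfderiv (𝓡 n) (𝓡 n) e.symm y
  G.bilinearComp D D

theorem chartMetric_apply (g : SmoothMetric n F)
    (e : OpenPartialHomeomorph F (EuclideanSpace ℝ (Fin n))) (y v w : EuclideanSpace ℝ (Fin n)) :
    chartMetric g e y v w = g.inner (e.symm y) (mfderiv (𝓡 n) (𝓡 n) e.symm y v)
      (mfderiv (𝓡 n) (𝓡 n) e.symm y w) := rfl

theorem metricMatrix_eq (g : SmoothMetric n F)
    (e : OpenPartialHomeomorph F (EuclideanSpace ℝ (Fin n))) (y : EuclideanSpace ℝ (Fin n))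
    (i j : Fin n) :
    metricMatrix g e y i j =
      chartMetric g e y (EuclideanSpace.single i 1) (EuclideanSpace.single j 1) := rfl

theorem chartMetric_symm (g : SmoothMetric n F)
    (e : OpenPartialHomeomorph F (EuclideanSpace ℝ (Fin n))) (y v w : EuclideanSpace ℝ (Fin n)) :
    chartMetric g e y v w = chartMetric g e y w v := by
  rw [chartMetric_apply, chartMetric_apply]
  exact g.symm _ _ _

theorem chartMetric_pos (g : SmoothMetric n F)
    {e : OpenPartialHomeomorph F (EuclideanSpace ℝ (Fin n))}
    (he : e ∈ atlas (EuclideanSpace ℝ (Fin n)) F) {y : EuclideanSpace ℝ (Fin n)}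
    (hy : y ∈ e.target) {v : EuclideanSpace ℝ (Fin n)} (hv : v ≠ 0) :
    0 < chartMetric g e y v v := by
  have hm : e.MDifferentiable (𝓡 n) (𝓡 n) :=
    haveI : IsManifold (𝓡 n) 1 F := IsManifold.of_le (n := ∞) (by norm_num)
    mdifferentiable_of_mem_atlas he
  have hinj := hm.symm.mfderiv_injective hy
  have hne : mfderiv (𝓡 n) (𝓡 n) e.symm y v ≠ 0 := by
    intro h
    have h0 : mfderiv (𝓡 n) (𝓡 n) e.symm y (0 : TangentSpace (𝓡 n) y) = 0 := map_zero _
    exact hv (hinj (h.trans h0.symm))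
  rw [chartMetric_apply]
  exact g.pos _ _ hne

theorem contDiffOn_chartMetric (g : SmoothMetric n F)
    {e : OpenPartialHomeomorph F (EuclideanSpace ℝ (Fin n))}
    (he : e ∈ atlas (EuclideanSpace ℝ (Fin n)) F) :
    ContDiffOn ℝ ∞ (chartMetric g e) e.target := by
  have hs : ContMDiffOn (𝓡 n) (𝓡 n) ∞ e.symm e.target :=
    contMDiffOn_symm_of_mem_maximalAtlas (IsManifold.subset_maximalAtlas he)
  -- The push-forward of the constant field `v` is the tangent map of `e.symm` applied to a constant
  -- section, hence a smooth section along `e.symm`; the bundle metric can then be evaluated on two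
  -- such sections.
  have key : ∀ v : EuclideanSpace ℝ (Fin n), ContMDiffOn (𝓡 n) ((𝓡 n).prod (𝓡 n)) ∞
      (fun z => (⟨e.symm z, mfderiv (𝓡 n) (𝓡 n) e.symm z v⟩ : TangentBundle (𝓡 n) F))
      e.target := by
    intro v
    have h1 := hs.contMDiffOn_tangentMapWithin (m := ∞) (by simp) e.open_target.uniqueMDiffOn
    have h2 : ContMDiff (𝓡 n) ((𝓡 n).prod (𝓡 n)) ∞
        (fun z => (⟨z, v⟩ : TangentBundle (𝓡 n) (EuclideanSpace ℝ (Fin n)))) := by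
      intro z
      rw [Bundle.contMDiffAt_totalSpace]
      refine ⟨contMDiffAt_id, ?_⟩
      have h : (fun w : EuclideanSpace ℝ (Fin n) => ((trivializationAt (EuclideanSpace ℝ (Fin n))
          (TangentSpace (𝓡 n)) z) (⟨w, v⟩ : TangentBundle (𝓡 n) (EuclideanSpace ℝ (Fin n)))).2)
          = fun _ => v := by
        funext w
        simp only [TangentBundle.trivializationAt_apply]
        simp [chartAt_self_eq, fderiv_id]
      exact h ▸ contMDiffAt_const
    have h3 := h1.comp h2.contMDiffOn (s := e.target) (fun z hz => hz)
    have h4 : ∀ z ∈ e.target, (⟨e.symm z, mfderiv (𝓡 n) (𝓡 n) e.symm z v⟩ : TangentBundle (𝓡 n) F)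
      = tangentMapWithin (𝓡 n) (𝓡 n) e.symm e.target ⟨z, v⟩ := by
      intro z hz
      simp only [tangentMapWithin]
      rw [mfderivWithin_of_isOpen e.open_target hz]
    exact h3.congr h4
  refine contDiffOn_clm_apply.2 fun v => contDiffOn_clm_apply.2 fun w => ?_
  rw [← contMDiffOn_iff_contDiffOn]
  have h := ContMDiffOn.clm_bundle_apply₂ (F₁ := EuclideanSpace ℝ (Fin n))
    (F₂ := EuclideanSpace ℝ (Fin n)) (F₃ := ℝ) (E₃ := Bundle.Trivial F ℝ)
    (g.contMDiff.comp_contMDiffOn hs) (key v) (key w)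
  intro z hz
  have h' := h z hz
  rw [Bundle.contMDiffWithinAt_totalSpace] at h'
  exact h'.2

end

/-- Coordinate space `ℝⁿ`. -/
abbrev Euc (n : ℕ) := EuclideanSpace ℝ (Fin n)

/-- Bilinear forms on coordinate space. -/
abbrev EucForm (n : ℕ) := Euc n →L[ℝ] Euc n →L[ℝ] ℝ

/-- The `i`-th standard basis vector. -/
abbrev stdVec {n : ℕ} (i : Fin n) : Euc n := EuclideanSpace.single i 1

/-! ### Linear algebra: the trace of one bilinear form with respect to another. -/

section Forms

variable {n : ℕ}

theorem sum_smul_stdVec (u : Euc n) : ∑ i, u i • stdVec i = u := by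
  ext j
  simp [Pi.single_apply]

theorem map_eq_sum_stdVec {G : Type*} [AddCommGroup G] [Module ℝ G] [TopologicalSpace G]
    (l : Euc n →L[ℝ] G) (u : Euc n) : l u = ∑ i, u i • l (stdVec i) := by
  conv_lhs => rw [← sum_smul_stdVec u]
  simp only [map_sum, map_smul]

/-- The Gram matrix of a bilinear form. -/
def formMatrix (β : EucForm n) : Matrix (Fin n) (Fin n) ℝ :=
  Matrix.of fun i j => β (stdVec i) (stdVec j)

/-- The trace of the bilinear form `β` with respect to the bilinear form `B`. -/
def formTrace (B β : EucForm n) : ℝ :=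
  ∑ i, ∑ j, (formMatrix B)⁻¹ i j * β (stdVec i) (stdVec j)

theorem formTrace_eq_trace (B β : EucForm n) :
    formTrace B β = ((formMatrix B)⁻¹ * (formMatrix β).transpose).trace := by
  simp [formTrace, Matrix.trace, Matrix.mul_apply, formMatrix]

/-- The matrix of a linear map. -/
def mapMatrix (J : Euc n →L[ℝ] Euc n) : Matrix (Fin n) (Fin n) ℝ :=
  Matrix.of fun a i => J (stdVec i) a

theorem formMatrix_bilinearComp (β : EucForm n) (J : Euc n →L[ℝ] Euc n) :
    formMatrix (β.bilinearComp J J) = (mapMatrix J).transpose * formMatrix β * mapMatrix J := by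
  ext i j
  simp only [formMatrix, mapMatrix, Matrix.of_apply, Matrix.mul_apply, Matrix.transpose_apply,
    ContinuousLinearMap.bilinearComp_apply]
  rw [map_eq_sum_stdVec (β (J (stdVec i)))]
  refine Finset.sum_congr rfl fun b _ => ?_
  rw [map_eq_sum_stdVec β (J (stdVec i)), smul_eq_mul, mul_comm]
  simp

theorem isUnit_det_mapMatrix {J : Euc n →L[ℝ] Euc n} (hJ : Function.Bijective J) :
    IsUnit (mapMatrix J).det := by
  have h : mapMatrix J = LinearMap.toMatrix (EuclideanSpace.basisFun (Fin n) ℝ).toBasis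
      (EuclideanSpace.basisFun (Fin n) ℝ).toBasis (J : Euc n →ₗ[ℝ] Euc n) := by
    ext a i
    simp [mapMatrix, LinearMap.toMatrix_apply]
  rw [h]
  exact LinearEquiv.isUnit_det (LinearEquiv.ofBijective (J : Euc n →ₗ[ℝ] Euc n) hJ) _ _

/-- Both Gram matrices are conjugated as `Jᵀ · J`; in `B⁻¹ βᵀ` the factors `J` cancel by cyclicity
of the trace. -/
theorem formTrace_bilinearComp (B β : EucForm n) {J : Euc n →L[ℝ] Euc n}
    (hJ : Function.Bijective J) :
    formTrace (B.bilinearComp J J) (β.bilinearComp J J) = formTrace B β := by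
  have hu := isUnit_det_mapMatrix hJ
  have hut : IsUnit (mapMatrix J).transpose.det := by rwa [Matrix.det_transpose]
  rw [formTrace_eq_trace, formTrace_eq_trace, formMatrix_bilinearComp, formMatrix_bilinearComp,
    Matrix.mul_inv_rev, Matrix.mul_inv_rev]
  simp only [Matrix.transpose_mul, Matrix.transpose_transpose]
  rw [Matrix.trace_mul_comm]
  simp only [← Matrix.mul_assoc]
  rw [Matrix.mul_assoc _ (mapMatrix J), Matrix.mul_nonsing_inv _ hu, Matrix.mul_one,
    Matrix.trace_mul_comm]
  simp only [← Matrix.mul_assoc]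
  rw [Matrix.nonsing_inv_mul _ hut, Matrix.one_mul, Matrix.trace_mul_comm]

theorem formMatrix_posDef {B : EucForm n} (hs : ∀ u v, B u v = B v u)
    (hp : ∀ v, v ≠ 0 → 0 < B v v) : (formMatrix B).PosDef := by
  refine Matrix.PosDef.of_dotProduct_mulVec_pos ?_ fun x hx => ?_
  · ext i j
    simp [formMatrix, hs]
  · have h : star x ⬝ᵥ (formMatrix B).mulVec x = B (WithLp.toLp 2 x) (WithLp.toLp 2 x) := by
      rw [map_eq_sum_stdVec B]
      simp only [dotProduct, Matrix.mulVec, formMatrix, star_trivial, Matrix.of_apply,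
        _root_.sum_apply, _root_.smul_apply, smul_eq_mul]
      refine Finset.sum_congr rfl fun i _ => ?_
      rw [map_eq_sum_stdVec (B (stdVec i))]
      simp [mul_comm]
    rw [h]
    refine hp _ fun h0 => hx ?_
    ext i
    simpa using congrArg (fun u : Euc n => u i) h0

/-- The tensor product of two linear forms. -/
def tensorForm (a b : Euc n →L[ℝ] ℝ) : EucForm n := a.smulRight b

theorem tensorForm_apply (a b : Euc n →L[ℝ] ℝ) (u v : Euc n) :
    tensorForm a b u v = a u * b v := by
  simp [tensorForm]

/-- This trace is the quadratic form of the inverse Gram matrix at the coefficients of `a`, that is,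
the squared dual norm of `a`. -/
theorem formTrace_tensor_self_pos {B : EucForm n} (hs : ∀ u v, B u v = B v u)
    (hp : ∀ v, v ≠ 0 → 0 < B v v) {a : Euc n →L[ℝ] ℝ} (ha : a ≠ 0) :
    0 < formTrace B (tensorForm a a) := by
  have h := (formMatrix_posDef hs hp).inv.dotProduct_mulVec_pos (x := fun i => a (stdVec i)) (by
    intro h0
    refine ha ?_
    ext u
    rw [map_eq_sum_stdVec]
    simp [fun i => congrFun h0 i])
  refine h.trans_eq ?_
  simp only [formTrace, tensorForm_apply, dotProduct, Matrix.mulVec, star_trivial, Finset.mul_sum]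
  refine Finset.sum_congr rfl fun i _ => Finset.sum_congr rfl fun j _ => ?_
  ring

theorem formTrace_tensor_self_nonneg {B : EucForm n} (hs : ∀ u v, B u v = B v u)
    (hp : ∀ v, v ≠ 0 → 0 < B v v) (a : Euc n →L[ℝ] ℝ) :
    0 ≤ formTrace B (tensorForm a a) := by
  rcases eq_or_ne a 0 with rfl | ha
  · simp [formTrace, tensorForm_apply]
  · exact (formTrace_tensor_self_pos hs hp ha).le

theorem formTrace_tensor_comm {B : EucForm n} (hs : ∀ u v, B u v = B v u)
    (a b : Euc n →L[ℝ] ℝ) : formTrace B (tensorForm a b) = formTrace B (tensorForm b a) := by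
  have h : (formMatrix B).transpose = formMatrix B := by
    ext i j
    simp [formMatrix, hs]
  have h' : ∀ i j, (formMatrix B)⁻¹ i j = (formMatrix B)⁻¹ j i := fun i j => by
    conv_rhs => rw [← h, ← Matrix.transpose_nonsing_inv, Matrix.transpose_apply]
  unfold formTrace
  rw [Finset.sum_comm]
  refine Finset.sum_congr rfl fun i _ => Finset.sum_congr rfl fun j _ => ?_
  rw [h' j i, tensorForm_apply, tensorForm_apply, mul_comm (a _)]

theorem formTrace_add (B β γ : EucForm n) :
    formTrace B (β + γ) = formTrace B β + formTrace B γ := by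
  simp only [formTrace, _root_.add_apply, mul_add, Finset.sum_add_distrib]

theorem formTrace_smul (B : EucForm n) (c : ℝ) (β : EucForm n) :
    formTrace B (c • β) = c * formTrace B β := by
  simp only [formTrace, _root_.smul_apply, smul_eq_mul, Finset.mul_sum]
  refine Finset.sum_congr rfl fun i _ => Finset.sum_congr rfl fun j _ => ?_
  ring

end Forms

/-! ### Transformation of the Christoffel symbols of the first kind. -/

section Koszul

variable {n : ℕ}

/-- The Christoffel symbols of the first kind of the metric `B` in coordinates. -/
def koszul (B : Euc n → EucForm n) (y u v w : Euc n) : ℝ :=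
  (1 / 2) * (fderiv ℝ B y u v w + fderiv ℝ B y v u w - fderiv ℝ B y w u v)

theorem fderiv_form_apply {B : Euc n → EucForm n} {y : Euc n} (hB : DifferentiableAt ℝ B y)
    (u v w : Euc n) : fderiv ℝ (fun z => B z v w) y u = fderiv ℝ B y u v w := by
  have h := (hB.hasFDerivAt.clm_apply (hasFDerivAt_const v y)).clm_apply (hasFDerivAt_const w y)
  rw [h.fderiv]
  simp

/-- The Leibniz rule produces six terms with second derivatives of `φ`. By symmetry of `D²φ` and of
`B'`, four cancel in pairs and the other two coincide, which uses up the factor `1/2`. -/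
theorem koszul_pullback {B B' : Euc n → EucForm n} {φ : Euc n → Euc n} {y : Euc n}
    (hB : DifferentiableAt ℝ B y) (hB' : DifferentiableAt ℝ B' (φ y))
    (hφ : ContDiffAt ℝ ∞ φ y) (hs : ∀ u v, B' (φ y) u v = B' (φ y) v u)
    (h : ∀ᶠ z in 𝓝 y, B z = (B' (φ z)).bilinearComp (fderiv ℝ φ z) (fderiv ℝ φ z))
    (u v w : Euc n) :
    koszul B y u v w = koszul B' (φ y) (fderiv ℝ φ y u) (fderiv ℝ φ y v) (fderiv ℝ φ y w)
      + B' (φ y) (fderiv ℝ (fderiv ℝ φ) y u v) (fderiv ℝ φ y w) := by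
  have hφ1 : HasFDerivAt φ (fderiv ℝ φ y) y :=
    (hφ.differentiableAt (by simp)).hasFDerivAt
  have hφ2 : HasFDerivAt (fderiv ℝ φ) (fderiv ℝ (fderiv ℝ φ) y) y :=
    ((hφ.fderiv_right (m := 1) (by norm_cast)).differentiableAt (by simp)).hasFDerivAt
  have hsymm : ∀ a b, fderiv ℝ (fderiv ℝ φ) y a b = fderiv ℝ (fderiv ℝ φ) y b a :=
    (hφ.isSymmSndFDerivAt (by simp; norm_cast))
  have key : ∀ a b c, fderiv ℝ B y a b c =
      fderiv ℝ B' (φ y) (fderiv ℝ φ y a) (fderiv ℝ φ y b) (fderiv ℝ φ y c)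
      + B' (φ y) (fderiv ℝ (fderiv ℝ φ) y a b) (fderiv ℝ φ y c)
      + B' (φ y) (fderiv ℝ φ y b) (fderiv ℝ (fderiv ℝ φ) y a c) := by
    intro a b c
    rw [← fderiv_form_apply hB]
    have h1 : (fun z => B z b c) =ᶠ[𝓝 y] fun z => B' (φ z) (fderiv ℝ φ z b) (fderiv ℝ φ z c) := by
      filter_upwards [h] with z hz
      rw [hz]
      rfl
    rw [h1.fderiv_eq]
    have hP : HasFDerivAt (fun z => B' (φ z)) ((fderiv ℝ B' (φ y)).comp (fderiv ℝ φ y)) y :=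
      HasFDerivAt.comp (g := B') (f := φ) y hB'.hasFDerivAt hφ1
    have hQ : ∀ d, HasFDerivAt (fun z => fderiv ℝ φ z d) ((fderiv ℝ (fderiv ℝ φ) y).flip d) y := by
      intro d
      refine (hφ2.clm_apply (hasFDerivAt_const d y)).congr_fderiv ?_
      simp
    have h2 := (hP.clm_apply (hQ b)).clm_apply (hQ c)
    rw [h2.fderiv]
    simp only [_root_.add_apply, ContinuousLinearMap.comp_apply, ContinuousLinearMap.flip_apply]
    ring
  unfold koszul
  rw [key, key, key, hsymm v u, hsymm w u, hsymm w v, hs _ (fderiv ℝ (fderiv ℝ φ) y u w),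
    hs (fderiv ℝ φ y u)]
  ring

end Koszul

section

variable {n : ℕ} {F : Type*} [TopologicalSpace F]
  [ChartedSpace (EuclideanSpace ℝ (Fin n)) F] [IsManifold (𝓡 n) ∞ F]

/-! ### Christoffel symbols as a vector-valued bilinear map. -/

section Christoffel

theorem IsLinearMap.eq_sum_stdVec {l : Euc n → ℝ} (h : IsLinearMap ℝ l) (u : Euc n) :
    l u = ∑ i, u i * l (stdVec i) := by
  have := map_eq_sum_stdVec (LinearMap.toContinuousLinearMap h.mk') u
  simpa using this

theorem koszul_eq_sum (B : Euc n → EucForm n) (y u v w : Euc n) :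
    koszul B y u v w = ∑ a, ∑ b, u a * (v b * koszul B y (stdVec a) (stdVec b) w) := by
  have h1 : ∀ v w, IsLinearMap ℝ (fun u => koszul B y u v w) := fun v w =>
    ⟨fun _ _ => by simp [koszul]; ring, fun _ _ => by simp [koszul]; ring⟩
  have h2 : ∀ u w, IsLinearMap ℝ (fun v => koszul B y u v w) := fun v w =>
    ⟨fun _ _ => by simp [koszul]; ring, fun _ _ => by simp [koszul]; ring⟩
  rw [IsLinearMap.eq_sum_stdVec (h1 v w) u]
  refine Finset.sum_congr rfl fun a _ => ?_
  rw [IsLinearMap.eq_sum_stdVec (h2 (stdVec a) w) v, Finset.mul_sum]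

theorem koszul_eq_sum_right (B : Euc n → EucForm n) (y u v w : Euc n) :
    koszul B y u v w = ∑ c, w c * koszul B y u v (stdVec c) :=
  IsLinearMap.eq_sum_stdVec (l := fun w => koszul B y u v w)
    ⟨fun _ _ => by simp [koszul]; ring, fun _ _ => by simp [koszul]; ring⟩ w

variable (g : SmoothMetric n F) (e : OpenPartialHomeomorph F (Euc n))

/-- The covariant derivative `∇_{∂ᵢ} ∂ⱼ` in the chart `e`. -/
def christoffelVec (y : Euc n) (i j : Fin n) : Euc n :=
  ∑ k, christoffel g e k i j y • stdVec k

/-- The Christoffel symbols in the chart `e`, as a vector-valued bilinear map. -/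
def christoffelMap (y : Euc n) : Euc n →L[ℝ] Euc n →L[ℝ] Euc n :=
  ∑ a, ∑ b, (EuclideanSpace.proj a : Euc n →L[ℝ] ℝ).smulRight
    ((EuclideanSpace.proj b : Euc n →L[ℝ] ℝ).smulRight (christoffelVec g e y a b))

theorem christoffelMap_apply (y u v : Euc n) :
    christoffelMap g e y u v = ∑ a, ∑ b, u a • v b • christoffelVec g e y a b := by
  simp [christoffelMap, _root_.sum_apply]

theorem christoffelMap_stdVec (y : Euc n) (i j : Fin n) :
    christoffelMap g e y (stdVec i) (stdVec j) = christoffelVec g e y i j := by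
  simp [christoffelMap_apply]

variable {e}

theorem chartMetric_differentiableAt (he : e ∈ atlas (Euc n) F) {y : Euc n} (hy : y ∈ e.target) :
    DifferentiableAt ℝ (chartMetric g e) y :=
  ((contDiffOn_chartMetric g he).differentiableOn (by simp)).differentiableAt
    (e.open_target.mem_nhds hy)

theorem metricMatrix_posDef (he : e ∈ atlas (Euc n) F) {y : Euc n} (hy : y ∈ e.target) :
    (metricMatrix g e y).PosDef :=
  formMatrix_posDef (B := chartMetric g e y) (chartMetric_symm g e y)
    fun _ hv => chartMetric_pos g he hy hv

theorem christoffel_eq (he : e ∈ atlas (Euc n) F) {y : Euc n} (hy : y ∈ e.target) (k i j : Fin n) :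
    christoffel g e k i j y =
      ∑ l, (metricMatrix g e y)⁻¹ k l
        * koszul (chartMetric g e) y (stdVec i) (stdVec j) (stdVec l) := by
  have hd := chartMetric_differentiableAt g he hy
  have hp : ∀ i j l, pderiv i (fun z => metricMatrix g e z j l) y
      = fderiv ℝ (chartMetric g e) y (stdVec i) (stdVec j) (stdVec l) := fun i j l =>
    fderiv_form_apply hd _ _ _
  simp only [christoffel, invMetric, hp, koszul, Finset.mul_sum]
  refine Finset.sum_congr rfl fun l _ => ?_
  ring

/-- Lowering the index cancels the inverse matrix. This characterises the Christoffel map without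
inverses, the form in which a change of chart is tractable. -/
theorem chartMetric_christoffelMap (he : e ∈ atlas (Euc n) F) {y : Euc n} (hy : y ∈ e.target)
    (u v w : Euc n) :
    chartMetric g e y (christoffelMap g e y u v) w = koszul (chartMetric g e) y u v w := by
  have hdet : IsUnit (metricMatrix g e y).det := (metricMatrix_posDef g he hy).det_pos.ne'.isUnit
  have hb : ∀ i j c, chartMetric g e y (christoffelVec g e y i j) (stdVec c)
      = koszul (chartMetric g e) y (stdVec i) (stdVec j) (stdVec c) := by
    intro i j c
    have hm : (metricMatrix g e y).mulVec ((metricMatrix g e y)⁻¹.mulVec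
        (fun l => koszul (chartMetric g e) y (stdVec i) (stdVec j) (stdVec l))) c
        = koszul (chartMetric g e) y (stdVec i) (stdVec j) (stdVec c) := by
      rw [Matrix.mulVec_mulVec, Matrix.mul_nonsing_inv _ hdet, Matrix.one_mulVec]
    rw [← hm]
    simp only [christoffelVec, map_sum, map_smul, _root_.sum_apply, _root_.smul_apply,
      smul_eq_mul, christoffel_eq g he hy]
    simp only [Matrix.mulVec, dotProduct]
    refine Finset.sum_congr rfl fun k _ => ?_
    rw [mul_comm, metricMatrix_eq, chartMetric_symm]
  rw [koszul_eq_sum, christoffelMap_apply]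
  simp only [map_sum, map_smul, _root_.sum_apply, _root_.smul_apply, smul_eq_mul]
  refine Finset.sum_congr rfl fun a _ => Finset.sum_congr rfl fun b _ => ?_
  rw [map_eq_sum_stdVec (chartMetric g e y _) w, koszul_eq_sum_right]
  simp only [hb, smul_eq_mul]

end Christoffel

/-! ### The Laplacian as the trace of the Hessian. -/

section Hessian

variable (g : SmoothMetric n F) (e : OpenPartialHomeomorph F (Euc n))

/-- The Hessian of `f` in the chart `e`. -/
def chartHessian (f : F → ℝ) (y : Euc n) : EucForm n :=
  fderiv ℝ (fderiv ℝ (f ∘ e.symm)) y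
    - (ContinuousLinearMap.compL ℝ (Euc n) (Euc n) ℝ (fderiv ℝ (f ∘ e.symm) y)).comp
      (christoffelMap g e y)

theorem chartHessian_apply (f : F → ℝ) (y u v : Euc n) :
    chartHessian g e f y u v = fderiv ℝ (fderiv ℝ (f ∘ e.symm)) y u v
      - fderiv ℝ (f ∘ e.symm) y (christoffelMap g e y u v) := by
  simp [chartHessian]

theorem pderiv_pderiv {h : Euc n → ℝ} {y : Euc n} (hh : ContDiffAt ℝ ∞ h y) (i j : Fin n) :
    pderiv i (pderiv j h) y = fderiv ℝ (fderiv ℝ h) y (stdVec i) (stdVec j) := by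
  have h2 : HasFDerivAt (fderiv ℝ h) (fderiv ℝ (fderiv ℝ h) y) y :=
    ((hh.fderiv_right (m := 1) (by norm_cast)).differentiableAt (by simp)).hasFDerivAt
  have h3 := h2.clm_apply (hasFDerivAt_const (stdVec j : Euc n) y)
  unfold pderiv
  rw [h3.fderiv]
  simp

theorem laplacianInChart_eq_formTrace {f : F → ℝ} {y : Euc n}
    (hf : ContDiffAt ℝ ∞ (f ∘ e.symm) y) :
    laplacianInChart g e f y = formTrace (chartMetric g e y) (chartHessian g e f y) := by
  unfold laplacianInChart formTrace
  refine Finset.sum_congr rfl fun i _ => Finset.sum_congr rfl fun j _ => ?_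
  rw [pderiv_pderiv hf, chartHessian_apply, christoffelMap_stdVec]
  simp only [christoffelVec, map_sum, map_smul, smul_eq_mul]
  rfl

end Hessian

end

section

variable {n : ℕ} {F : Type*} [TopologicalSpace F]
  [ChartedSpace (EuclideanSpace ℝ (Fin n)) F] [IsManifold (𝓡 n) ∞ F]

/-! ### Chart independence of the Laplacian. -/

section Transition

variable (g : SmoothMetric n F) {e e' : OpenPartialHomeomorph F (Euc n)}

theorem atlas_mdifferentiable (he : e ∈ atlas (Euc n) F) : e.MDifferentiable (𝓡 n) (𝓡 n) :=
  haveI : IsManifold (𝓡 n) 1 F := IsManifold.of_le (n := ∞) (by norm_num)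
  mdifferentiable_of_mem_atlas he

theorem contDiffOn_comp_symm (he : e ∈ atlas (Euc n) F) {f : F → ℝ}
    (hf : ContMDiff (𝓡 n) 𝓘(ℝ, ℝ) ∞ f) : ContDiffOn ℝ ∞ (f ∘ e.symm) e.target := by
  rw [← contMDiffOn_iff_contDiffOn]
  exact hf.comp_contMDiffOn (contMDiffOn_symm_of_mem_maximalAtlas
    (IsManifold.subset_maximalAtlas he))

theorem contDiffAt_comp_symm (he : e ∈ atlas (Euc n) F) {f : F → ℝ}
    (hf : ContMDiff (𝓡 n) 𝓘(ℝ, ℝ) ∞ f) {y : Euc n} (hy : y ∈ e.target) :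
    ContDiffAt ℝ ∞ (f ∘ e.symm) y :=
  (contDiffOn_comp_symm he hf).contDiffAt (e.open_target.mem_nhds hy)

theorem contDiffAt_transition (he : e ∈ atlas (Euc n) F) (he' : e' ∈ atlas (Euc n) F)
    {y : Euc n} (hy : y ∈ e.target) (hy' : e.symm y ∈ e'.source) :
    ContDiffAt ℝ ∞ (e' ∘ e.symm) y := by
  rw [← contMDiffAt_iff_contDiffAt]
  have h1 : ContMDiffAt (𝓡 n) (𝓡 n) ∞ e.symm y :=
    (contMDiffOn_symm_of_mem_maximalAtlas (IsManifold.subset_maximalAtlas he)).contMDiffAt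
      (e.open_target.mem_nhds hy)
  have h2 : ContMDiffAt (𝓡 n) (𝓡 n) ∞ e' (e.symm y) :=
    (contMDiffOn_of_mem_maximalAtlas (IsManifold.subset_maximalAtlas he')).contMDiffAt
      (e'.open_source.mem_nhds hy')
  exact h2.comp y h1

theorem fderiv_transition_bijective (he : e ∈ atlas (Euc n) F) (he' : e' ∈ atlas (Euc n) F)
    {y : Euc n} (hy : y ∈ e.target) (hy' : e.symm y ∈ e'.source) :
    Function.Bijective (fderiv ℝ (e' ∘ e.symm) y) := by
  have hm := atlas_mdifferentiable he
  have hm' := atlas_mdifferentiable he'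
  have h : mfderiv (𝓡 n) (𝓡 n) (e' ∘ e.symm) y
      = (mfderiv (𝓡 n) (𝓡 n) e' (e.symm y)).comp (mfderiv (𝓡 n) (𝓡 n) e.symm y) :=
    mfderiv_comp y (hm'.mdifferentiableAt hy') (hm.mdifferentiableAt_symm hy)
  rw [mfderiv_eq_fderiv] at h
  rw [h]
  exact (hm'.mfderiv_bijective hy').comp (hm.symm.mfderiv_bijective hy)

theorem eventually_mem_target_source {y : Euc n} (hy : y ∈ e.target)
    (hy' : e.symm y ∈ e'.source) :
    ∀ᶠ z in 𝓝 y, z ∈ e.target ∧ e.symm z ∈ e'.source :=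
  (e.open_target.eventually_mem hy).and
    ((e.continuousAt_symm hy).eventually (e'.open_source.eventually_mem hy'))

theorem chartMetric_transition (he : e ∈ atlas (Euc n) F) (he' : e' ∈ atlas (Euc n) F)
    {y : Euc n} (hy : y ∈ e.target) (hy' : e.symm y ∈ e'.source) :
    chartMetric g e y = (chartMetric g e' (e' (e.symm y))).bilinearComp
      (fderiv ℝ (e' ∘ e.symm) y) (fderiv ℝ (e' ∘ e.symm) y) := by
  have hm := atlas_mdifferentiable he
  have hm' := atlas_mdifferentiable he'
  have hφ : MDifferentiableAt (𝓡 n) (𝓡 n) (e' ∘ e.symm) y :=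
    (hm'.mdifferentiableAt hy').comp y (hm.mdifferentiableAt_symm hy)
  have h1 : e.symm =ᶠ[𝓝 y] e'.symm ∘ (e' ∘ e.symm) := by
    filter_upwards [eventually_mem_target_source hy hy'] with z hz
    exact (e'.left_inv hz.2).symm
  have h2 : mfderiv (𝓡 n) (𝓡 n) (e'.symm ∘ (e' ∘ e.symm)) y
      = (mfderiv (𝓡 n) (𝓡 n) e'.symm ((e' ∘ e.symm) y)).comp
        (mfderiv (𝓡 n) (𝓡 n) (e' ∘ e.symm) y) :=
    mfderiv_comp y (hm'.mdifferentiableAt_symm (e'.map_source hy')) hφ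
  have h3 : (mfderiv (𝓡 n) (𝓡 n) e.symm y : Euc n →L[ℝ] Euc n)
      = (mfderiv (𝓡 n) (𝓡 n) e'.symm (e' (e.symm y)) : Euc n →L[ℝ] Euc n).comp
        (fderiv ℝ (e' ∘ e.symm) y) := by
    rw [mfderiv_eq_fderiv] at h2
    exact h1.mfderiv_eq.trans h2
  have h4 : ∀ p q : F, p = q → (g.inner p : EucForm n) = (g.inner q : EucForm n) := by
    rintro p _ rfl
    rfl
  have h5 := h4 _ _ (e'.left_inv hy').symm
  ext u v
  have h6 : chartMetric g e y u v = (g.inner (e.symm y) : EucForm n)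
      ((mfderiv (𝓡 n) (𝓡 n) e.symm y : Euc n →L[ℝ] Euc n) u)
      ((mfderiv (𝓡 n) (𝓡 n) e.symm y : Euc n →L[ℝ] Euc n) v) := rfl
  rw [h6, h3, h5]
  rfl

/-- The metric is nondegenerate and the derivative of the transition map is onto, so it suffices to
pair both sides with image vectors; the claim then becomes `koszul_pullback`. -/
theorem christoffelMap_transition (he : e ∈ atlas (Euc n) F) (he' : e' ∈ atlas (Euc n) F)
    {y : Euc n} (hy : y ∈ e.target) (hy' : e.symm y ∈ e'.source) (u v : Euc n) :
    fderiv ℝ (e' ∘ e.symm) y (christoffelMap g e y u v) =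
      christoffelMap g e' (e' (e.symm y)) (fderiv ℝ (e' ∘ e.symm) y u)
        (fderiv ℝ (e' ∘ e.symm) y v) + fderiv ℝ (fderiv ℝ (e' ∘ e.symm)) y u v := by
  have hy2 : e' (e.symm y) ∈ e'.target := e'.map_source hy'
  have hB : ∀ w, chartMetric g e' (e' (e.symm y))
      (fderiv ℝ (e' ∘ e.symm) y (christoffelMap g e y u v)) w
      = chartMetric g e' (e' (e.symm y)) (christoffelMap g e' (e' (e.symm y))
        (fderiv ℝ (e' ∘ e.symm) y u) (fderiv ℝ (e' ∘ e.symm) y v)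
        + fderiv ℝ (fderiv ℝ (e' ∘ e.symm)) y u v) w := by
    intro w'
    obtain ⟨w, rfl⟩ := (fderiv_transition_bijective he he' hy hy').2 w'
    have h1 := chartMetric_christoffelMap g he hy u v w
    rw [chartMetric_transition g he he' hy hy', ContinuousLinearMap.bilinearComp_apply] at h1
    rw [h1, koszul_pullback (B := chartMetric g e) (B' := chartMetric g e') (φ := e' ∘ e.symm)
      (chartMetric_differentiableAt g he hy) (chartMetric_differentiableAt g he' hy2)
      (contDiffAt_transition he he' hy hy') (chartMetric_symm g e' _), map_add,
      _root_.add_apply, chartMetric_christoffelMap g he' hy2]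
    · rfl
    · filter_upwards [eventually_mem_target_source hy hy'] with z hz
      exact chartMetric_transition g he he' hz.1 hz.2
  refine sub_eq_zero.1 (by_contra fun hne => ?_)
  have hp := chartMetric_pos g he' hy2 hne
  have h0 : ∀ w, chartMetric g e' (e' (e.symm y)) (fderiv ℝ (e' ∘ e.symm) y
      (christoffelMap g e y u v) - (christoffelMap g e' (e' (e.symm y))
        (fderiv ℝ (e' ∘ e.symm) y u) (fderiv ℝ (e' ∘ e.symm) y v)
        + fderiv ℝ (fderiv ℝ (e' ∘ e.symm)) y u v)) w = 0 := fun w => by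
    rw [map_sub, _root_.sub_apply, hB, sub_self]
  exact hp.ne' (h0 _)

theorem comp_symm_eventuallyEq (f : F → ℝ) {y : Euc n} (hy : y ∈ e.target)
    (hy' : e.symm y ∈ e'.source) :
    f ∘ e.symm =ᶠ[𝓝 y] (f ∘ e'.symm) ∘ (e' ∘ e.symm) := by
  filter_upwards [eventually_mem_target_source hy hy'] with z hz
  simp [e'.left_inv hz.2]

theorem fderiv_comp_symm_transition (he : e ∈ atlas (Euc n) F) (he' : e' ∈ atlas (Euc n) F)
    {f : F → ℝ} (hf : ContMDiff (𝓡 n) 𝓘(ℝ, ℝ) ∞ f)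
    {y : Euc n} (hy : y ∈ e.target) (hy' : e.symm y ∈ e'.source) :
    fderiv ℝ (f ∘ e.symm) y = (fderiv ℝ (f ∘ e'.symm) (e' (e.symm y))).comp
      (fderiv ℝ (e' ∘ e.symm) y) := by
  rw [(comp_symm_eventuallyEq (e' := e') f hy hy').fderiv_eq]
  exact fderiv_comp y ((contDiffAt_comp_symm he' hf (e'.map_source hy')).differentiableAt (by simp))
    ((contDiffAt_transition he he' hy hy').differentiableAt (by simp))

/-- The second derivative of a composite contains `df(D²φ)`, which the inhomogeneous term in the
transformation of the Christoffel map cancels. What remains is tensorial. -/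
theorem chartHessian_transition (he : e ∈ atlas (Euc n) F) (he' : e' ∈ atlas (Euc n) F)
    {f : F → ℝ} (hf : ContMDiff (𝓡 n) 𝓘(ℝ, ℝ) ∞ f)
    {y : Euc n} (hy : y ∈ e.target) (hy' : e.symm y ∈ e'.source) :
    chartHessian g e f y = (chartHessian g e' f (e' (e.symm y))).bilinearComp
      (fderiv ℝ (e' ∘ e.symm) y) (fderiv ℝ (e' ∘ e.symm) y) := by
  have hφ := contDiffAt_transition he he' hy hy'
  have hF := contDiffAt_comp_symm he' hf (e'.map_source hy')
  have hφ1 : HasFDerivAt (e' ∘ e.symm) (fderiv ℝ (e' ∘ e.symm) y) y :=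
    (hφ.differentiableAt (by simp)).hasFDerivAt
  have hφ2 : HasFDerivAt (fderiv ℝ (e' ∘ e.symm)) (fderiv ℝ (fderiv ℝ (e' ∘ e.symm)) y) y :=
    ((hφ.fderiv_right (m := 1) (by norm_cast)).differentiableAt (by simp)).hasFDerivAt
  have hF2 : HasFDerivAt (fderiv ℝ (f ∘ e'.symm))
      (fderiv ℝ (fderiv ℝ (f ∘ e'.symm)) (e' (e.symm y))) ((e' ∘ e.symm) y) :=
    ((hF.fderiv_right (m := 1) (by norm_cast)).differentiableAt (by simp)).hasFDerivAt
  have h1 : fderiv ℝ (f ∘ e.symm) =ᶠ[𝓝 y] fun z =>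
      (fderiv ℝ (f ∘ e'.symm) ((e' ∘ e.symm) z)).comp (fderiv ℝ (e' ∘ e.symm) z) := by
    filter_upwards [eventually_mem_target_source hy hy'] with z hz
    exact fderiv_comp_symm_transition he he' hf hz.1 hz.2
  have hP : HasFDerivAt (fun z => fderiv ℝ (f ∘ e'.symm) ((e' ∘ e.symm) z))
      ((fderiv ℝ (fderiv ℝ (f ∘ e'.symm)) (e' (e.symm y))).comp (fderiv ℝ (e' ∘ e.symm) y)) y :=
    HasFDerivAt.comp (g := fderiv ℝ (f ∘ e'.symm)) (f := e' ∘ e.symm) y hF2 hφ1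
  have h2 := hP.clm_comp hφ2
  ext u v
  rw [ContinuousLinearMap.bilinearComp_apply, chartHessian_apply, chartHessian_apply,
    h1.fderiv_eq, h2.fderiv, fderiv_comp_symm_transition he he' hf hy hy',
    ContinuousLinearMap.comp_apply, christoffelMap_transition g he he' hy hy']
  simp
  ring

theorem laplacianInChart_eq (he : e ∈ atlas (Euc n) F) (he' : e' ∈ atlas (Euc n) F)
    {f : F → ℝ} (hf : ContMDiff (𝓡 n) 𝓘(ℝ, ℝ) ∞ f) {x : F} (hx : x ∈ e.source)
    (hx' : x ∈ e'.source) :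
    laplacianInChart g e f (e x) = laplacianInChart g e' f (e' x) := by
  have hy := e.map_source hx
  have hxy : e.symm (e x) = x := e.left_inv hx
  have hy' : e.symm (e x) ∈ e'.source := by rwa [hxy]
  rw [laplacianInChart_eq_formTrace g e (contDiffAt_comp_symm he hf hy),
    laplacianInChart_eq_formTrace g e' (contDiffAt_comp_symm he' hf (e'.map_source hx')),
    chartMetric_transition g he he' hy hy', chartHessian_transition g he he' hf hy hy',
    formTrace_bilinearComp _ _ (fderiv_transition_bijective he he' hy hy'), hxy]

end Transition

/-! ### The inner product of gradients and its chart independence. -/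

section Gradient

variable (g : SmoothMetric n F)

/-- The inner product of the gradients of two functions, in the chart `e`. -/
def gradInnerInChart (e : OpenPartialHomeomorph F (Euc n)) (a b : F → ℝ) (y : Euc n) : ℝ :=
  formTrace (chartMetric g e y)
    (tensorForm (fderiv ℝ (a ∘ e.symm) y) (fderiv ℝ (b ∘ e.symm) y))

/-- The inner product of the gradients of two functions. -/
def gradInner (a b : F → ℝ) (x : F) : ℝ :=
  gradInnerInChart g (chartAt (Euc n) x) a b (chartAt (Euc n) x x)

theorem gradInnerInChart_eq {e e' : OpenPartialHomeomorph F (Euc n)}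
    (he : e ∈ atlas (Euc n) F) (he' : e' ∈ atlas (Euc n) F)
    {a b : F → ℝ} (ha : ContMDiff (𝓡 n) 𝓘(ℝ, ℝ) ∞ a) (hb : ContMDiff (𝓡 n) 𝓘(ℝ, ℝ) ∞ b)
    {x : F} (hx : x ∈ e.source) (hx' : x ∈ e'.source) :
    gradInnerInChart g e a b (e x) = gradInnerInChart g e' a b (e' x) := by
  have hy := e.map_source hx
  have hxy : e.symm (e x) = x := e.left_inv hx
  have hy' : e.symm (e x) ∈ e'.source := by rwa [hxy]
  have h : ∀ (l m : Euc n →L[ℝ] ℝ) (J : Euc n →L[ℝ] Euc n),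
      tensorForm (l.comp J) (m.comp J) = (tensorForm l m).bilinearComp J J := by
    intro l m J
    ext u v
    simp [tensorForm]
  rw [gradInnerInChart, gradInnerInChart, chartMetric_transition g he he' hy hy',
    fderiv_comp_symm_transition he he' ha hy hy', fderiv_comp_symm_transition he he' hb hy hy',
    h, formTrace_bilinearComp _ _ (fderiv_transition_bijective he he' hy hy'), hxy]

end Gradient

/-! ### Continuity of the Laplacian and of the gradient product. -/

section Continuity

variable (g : SmoothMetric n F) {e : OpenPartialHomeomorph F (Euc n)}

theorem contDiffOn_pderiv {U : Set (Euc n)} (hU : IsOpen U) {h : Euc n → ℝ}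
    (hh : ContDiffOn ℝ ∞ h U) (i : Fin n) : ContDiffOn ℝ ∞ (pderiv i h) U :=
  (hh.fderiv_of_isOpen hU (m := ∞) (by simp)).clm_apply contDiffOn_const

theorem contDiffOn_metricMatrix (he : e ∈ atlas (Euc n) F) (i j : Fin n) :
    ContDiffOn ℝ ∞ (fun y => metricMatrix g e y i j) e.target :=
  ((contDiffOn_chartMetric g he).clm_apply contDiffOn_const).clm_apply contDiffOn_const

theorem continuousOn_invMetric (he : e ∈ atlas (Euc n) F) (i j : Fin n) :
    ContinuousOn (invMetric g e i j) e.target := by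
  have h : ContinuousOn (fun y => metricMatrix g e y) e.target :=
    continuousOn_pi.2 fun i => continuousOn_pi.2 fun j =>
      (contDiffOn_metricMatrix g he i j).continuousOn
  intro y hy
  have hdet := (metricMatrix_posDef g he hy).det_pos.ne'
  have hinv : ContinuousAt (Ring.inverse : ℝ → ℝ) (metricMatrix g e y).det := by
    rw [Ring.inverse_eq_inv']
    exact continuousAt_inv₀ hdet
  have h1 := (continuousAt_matrix_inv _ hinv).comp_continuousWithinAt (h y hy)
  exact (continuous_apply_apply i j).continuousAt.comp_continuousWithinAt h1

theorem continuousOn_christoffel (he : e ∈ atlas (Euc n) F) (k i j : Fin n) :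
    ContinuousOn (christoffel g e k i j) e.target := by
  have hp : ∀ i j l, ContinuousOn (fun y => pderiv i (fun z => metricMatrix g e z j l) y)
      e.target := fun i j l =>
    (contDiffOn_pderiv e.open_target (contDiffOn_metricMatrix g he j l) i).continuousOn
  exact continuousOn_const.mul (continuousOn_finsetSum _ fun l _ =>
    (continuousOn_invMetric g he k l).mul (((hp i j l).add (hp j i l)).sub (hp l i j)))

theorem continuousOn_laplacianInChart (he : e ∈ atlas (Euc n) F) {f : F → ℝ}
    (hf : ContMDiff (𝓡 n) 𝓘(ℝ, ℝ) ∞ f) : ContinuousOn (laplacianInChart g e f) e.target := by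
  have hF := contDiffOn_comp_symm he hf
  have h1 := fun i => contDiffOn_pderiv e.open_target hF i
  exact continuousOn_finsetSum _ fun i _ => continuousOn_finsetSum _ fun j _ =>
    (continuousOn_invMetric g he i j).mul
      ((contDiffOn_pderiv e.open_target (h1 j) i).continuousOn.sub
        (continuousOn_finsetSum _ fun k _ =>
          (continuousOn_christoffel g he k i j).mul (h1 k).continuousOn))

theorem gradInnerInChart_eq_sum (e : OpenPartialHomeomorph F (Euc n)) (a b : F → ℝ) (y : Euc n) :
    gradInnerInChart g e a b y = ∑ i, ∑ j, invMetric g e i j y *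
      (pderiv i (a ∘ e.symm) y * pderiv j (b ∘ e.symm) y) := by
  simp only [gradInnerInChart, formTrace, tensorForm_apply]
  rfl

theorem continuousOn_gradInnerInChart (he : e ∈ atlas (Euc n) F) {a b : F → ℝ}
    (ha : ContMDiff (𝓡 n) 𝓘(ℝ, ℝ) ∞ a) (hb : ContMDiff (𝓡 n) 𝓘(ℝ, ℝ) ∞ b) :
    ContinuousOn (gradInnerInChart g e a b) e.target := by
  have h : gradInnerInChart g e a b = fun y => _ := funext (gradInnerInChart_eq_sum g e a b)
  rw [h]
  have h1 := fun i => contDiffOn_pderiv e.open_target (contDiffOn_comp_symm he ha) i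
  have h2 := fun i => contDiffOn_pderiv e.open_target (contDiffOn_comp_symm he hb) i
  exact continuousOn_finsetSum _ fun i _ => continuousOn_finsetSum _ fun j _ =>
    (continuousOn_invMetric g he i j).mul ((h1 i).continuousOn.mul (h2 j).continuousOn)

/-- The preferred chart may jump as `x` varies, so continuity is not visible from the definition of
`q`; chart independence allows one fixed chart to be used near each point. -/
theorem continuous_of_chart_expression {q : F → ℝ}
    {Q : OpenPartialHomeomorph F (Euc n) → Euc n → ℝ}
    (hq : ∀ x, q x = Q (chartAt (Euc n) x) (chartAt (Euc n) x x))
    (hQ : ∀ e ∈ atlas (Euc n) F, ∀ e' ∈ atlas (Euc n) F, ∀ x ∈ e.source, x ∈ e'.source →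
      Q e (e x) = Q e' (e' x))
    (hc : ∀ e ∈ atlas (Euc n) F, ContinuousOn (Q e) e.target) : Continuous q := by
  refine continuous_iff_continuousAt.2 fun p => ?_
  set e := chartAt (Euc n) p
  have he : e ∈ atlas (Euc n) F := chart_mem_atlas _ p
  have hp : p ∈ e.source := mem_chart_source _ p
  have h1 : ContinuousAt (fun x => Q e (e x)) p :=
    ((hc e he).continuousAt (e.open_target.mem_nhds (e.map_source hp))).comp (e.continuousAt hp)
  refine h1.congr ?_
  filter_upwards [e.open_source.mem_nhds hp] with x hx
  rw [hq]
  exact hQ e he _ (chart_mem_atlas _ x) x hx (mem_chart_source _ x)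

theorem continuous_laplacian {f : F → ℝ} (hf : ContMDiff (𝓡 n) 𝓘(ℝ, ℝ) ∞ f) :
    Continuous (laplacian g f) :=
  continuous_of_chart_expression (fun _ => rfl)
    (fun _ he _ he' _ hx hx' => laplacianInChart_eq g he he' hf hx hx')
    fun _ he => continuousOn_laplacianInChart g he hf

theorem continuous_gradInner {a b : F → ℝ} (ha : ContMDiff (𝓡 n) 𝓘(ℝ, ℝ) ∞ a)
    (hb : ContMDiff (𝓡 n) 𝓘(ℝ, ℝ) ∞ b) : Continuous (gradInner g a b) :=
  continuous_of_chart_expression (fun _ => rfl)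
    (fun _ he _ he' _ hx hx' => gradInnerInChart_eq g he he' ha hb hx hx')
    fun _ he => continuousOn_gradInnerInChart g he ha hb

end Continuity

end

/-! ### The one-variable profile that rounds off `min s 0`. -/

section Kink

theorem hasDerivAt_expNegInvGlue (x : ℝ) :
    HasDerivAt expNegInvGlue ((x⁻¹) ^ 2 * expNegInvGlue x) x := by
  have h := expNegInvGlue.hasDerivAt_polynomial_eval_inv_mul 1 x
  simpa using h

/-- A smooth concave replacement `η` of `s ↦ min s 0`, with derivative `w` and second
derivative `-b`, for which the defect `s w - η` from homogeneity is controlled by `b` and `1 - w`. -/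
theorem exists_smooth_concave_min : ∃ η w b : ℝ → ℝ, ContDiff ℝ ∞ η ∧
    (∀ s, HasDerivAt η (w s) s) ∧ (∀ s, HasDerivAt w (-b s) s) ∧
    (∀ s, 0 ≤ w s) ∧ (∀ s, 0 ≤ b s) ∧ (∀ s, 1 ≤ |s| → b s = 0) ∧
    (∀ s, 0 ≤ s * w s - η s) ∧ (∀ s, s * w s - η s ≤ b s) ∧ (∀ s, s * w s - η s ≤ 1 - w s) ∧
    (∀ s, 1 ≤ s → η s = 0) ∧ (∀ s, s ≤ -1 → η s = s) := by
  -- Chosen so that `-s * b₀ s` is the derivative of `exp (-1 / (1 - s ^ 2))`. The defect `Z`, which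
  -- must satisfy `Z' = -s b`, is then explicit and comparable with `b` up to the endpoints `±1`.
  set b₀ : ℝ → ℝ := fun s => 2 * (((1 - s ^ 2)⁻¹) ^ 2 * expNegInvGlue (1 - s ^ 2)) with hb₀
  have hb₀s : ContDiff ℝ ∞ b₀ := by
    have h := (expNegInvGlue.contDiff_polynomial_eval_inv_mul (n := ⊤) (Polynomial.X ^ 2)).comp
      (f := fun s : ℝ => 1 - s ^ 2) (by fun_prop)
    have h2 := contDiff_const (c := (2 : ℝ)).mul h
    simpa [Function.comp_def, hb₀] using h2
  have hb₀c : Continuous b₀ := hb₀s.continuous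
  have hb₀n : ∀ s, 0 ≤ b₀ s := fun s => by
    have := expNegInvGlue.nonneg (1 - s ^ 2)
    positivity
  have hb₀z : ∀ s, 1 ≤ |s| → b₀ s = 0 := fun s hs => by
    have h1 : 1 ≤ s ^ 2 := by
      rw [← sq_abs]
      nlinarith
    simp [hb₀, expNegInvGlue.zero_of_nonpos (sub_nonpos.2 h1)]
  set c : ℝ := ∫ t in (-1 : ℝ)..1, b₀ t with hc
  -- Dividing by the total mass `c` makes `w` fall from exactly `1` to exactly `0` across `[-1, 1]`.
  have hcpos : 0 < c := by
    refine intervalIntegral.intervalIntegral_pos_of_pos_on (hb₀c.intervalIntegrable _ _)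
      (fun x hx => ?_) (by norm_num)
    have h1 : 0 < 1 - x ^ 2 := by nlinarith [hx.1, hx.2]
    have := expNegInvGlue.pos_of_pos h1
    positivity
  set w : ℝ → ℝ := fun s => c⁻¹ * ∫ t in s..1, b₀ t with hw
  have hwd : ∀ s, HasDerivAt w (-(c⁻¹ * b₀ s)) s := fun s => by
    have h := intervalIntegral.integral_hasDerivAt_left (hb₀c.intervalIntegrable s 1)
      (hb₀c.stronglyMeasurableAtFilter _ _) hb₀c.continuousAt
    have h2 := h.const_mul c⁻¹
    rwa [mul_neg] at h2
  have hcb : ∀ s, 0 ≤ c⁻¹ * b₀ s := fun s => mul_nonneg (inv_nonneg.2 hcpos.le) (hb₀n s)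
  have hwanti : Antitone w := antitone_of_hasDerivAt_nonpos hwd fun s => neg_nonpos.2 (hcb s)
  have hw1 : ∀ s, 1 ≤ s → w s = 0 := fun s hs => by
    have h : ∫ t in s..1, b₀ t = 0 := by
      rw [intervalIntegral.integral_congr (g := fun _ => (0 : ℝ))]
      · simp
      · intro t ht
        rw [uIcc_of_ge hs] at ht
        exact hb₀z t (ht.1.trans (le_abs_self t))
    simp [hw, h]
  have hwm1 : ∀ s, s ≤ -1 → w s = 1 := fun s hs => by
    have h : ∫ t in s..(-1), b₀ t = 0 := by
      rw [intervalIntegral.integral_congr (g := fun _ => (0 : ℝ))]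
      · simp
      · intro t ht
        rw [uIcc_of_le hs] at ht
        exact hb₀z t ((by linarith [ht.2] : 1 ≤ -t).trans (neg_le_abs t))
    have h2 := intervalIntegral.integral_add_adjacent_intervals
      (hb₀c.intervalIntegrable s (-1)) (hb₀c.intervalIntegrable (μ := MeasureTheory.volume) (-1) 1)
    rw [h, zero_add] at h2
    simp only [hw]
    rw [← h2]
    exact inv_mul_cancel₀ hcpos.ne'
  have hw0 : ∀ s, 0 ≤ w s := fun s =>
    (hw1 (max s 1) (le_max_right _ _)).symm.le.trans (hwanti (le_max_left _ _))
  set Z : ℝ → ℝ := fun s => c⁻¹ * expNegInvGlue (1 - s ^ 2) with hZ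
  have hZd : ∀ s, HasDerivAt Z (-(s * (c⁻¹ * b₀ s))) s := fun s => by
    have h1 : HasDerivAt (fun s : ℝ => 1 - s ^ 2) (-(2 * s)) s := by
      simpa using (hasDerivAt_pow 2 s).const_sub 1
    have h2 := ((hasDerivAt_expNegInvGlue (1 - s ^ 2)).comp s h1).const_mul c⁻¹
    refine h2.congr_deriv ?_
    simp only [hb₀]
    ring
  have hZz : ∀ s, 1 ≤ |s| → Z s = 0 := fun s hs => by
    have h1 : 1 ≤ s ^ 2 := by
      rw [← sq_abs]
      nlinarith
    simp [hZ, expNegInvGlue.zero_of_nonpos (sub_nonpos.2 h1)]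
  have hZn : ∀ s, 0 ≤ Z s := fun s =>
    mul_nonneg (inv_nonneg.2 hcpos.le) (expNegInvGlue.nonneg _)
  -- Inside `(-1, 1)`, `b / Z = 2 / (1 - s ^ 2) ^ 2 ≥ 1`.
  have hZb : ∀ s, Z s ≤ c⁻¹ * b₀ s := fun s => by
    rcases le_or_gt 1 |s| with hs | hs
    · rw [hZz s hs]
      exact hcb s
    · refine mul_le_mul_of_nonneg_left ?_ (inv_nonneg.2 hcpos.le)
      have h1 : s ^ 2 < 1 := by
        rw [← sq_abs]
        nlinarith [abs_nonneg s]
      have h2 : 1 ≤ (1 - s ^ 2)⁻¹ := (one_le_inv₀ (by linarith)).2 (by nlinarith)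
      have h3 := expNegInvGlue.nonneg (1 - s ^ 2)
      have h4 : 1 ≤ ((1 - s ^ 2)⁻¹) ^ 2 := one_le_pow₀ h2
      simp only [hb₀]
      nlinarith
  -- `1 - w - Z` vanishes for `s ≤ -1` and has derivative `(1 + s) b`, which is nonnegative
  -- everywhere since `b = 0` for `s ≤ -1`.
  have hZw : ∀ s, Z s ≤ 1 - w s := fun s => by
    have hmono : Monotone (fun s => 1 - w s - Z s) := by
      refine monotone_of_hasDerivAt_nonneg (f' := fun s => (1 + s) * (c⁻¹ * b₀ s))
        (fun s => (((hwd s).const_sub 1).sub (hZd s)).congr_deriv (by ring)) fun s => ?_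
      rcases le_or_gt s (-1) with hs | hs
      · have := hb₀z s ((by linarith : 1 ≤ -s).trans (neg_le_abs s))
        simp [this]
      · exact mul_nonneg (by linarith) (hcb s)
    have h := hmono (min_le_left s (-1))
    have h1 : Z (min s (-1)) = 0 :=
      hZz _ ((by linarith [min_le_right s (-1 : ℝ)] : 1 ≤ -min s (-1)).trans (neg_le_abs _))
    simp only [h1, hwm1 _ (min_le_right s (-1 : ℝ))] at h
    linarith
  have hηd : ∀ s, HasDerivAt (fun s => s * w s - Z s) (w s) s := fun s => by
    refine (((hasDerivAt_id s).mul (hwd s)).sub (hZd s)).congr_deriv ?_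
    simp
  have hws : ContDiff ℝ ∞ w := by
    rw [contDiff_infty_iff_deriv]
    refine ⟨fun s => (hwd s).differentiableAt, ?_⟩
    rw [funext fun s => (hwd s).deriv]
    exact (contDiff_const.mul hb₀s).neg
  refine ⟨fun s => s * w s - Z s, w, fun s => c⁻¹ * b₀ s, ?_, hηd, hwd, hw0, hcb,
    fun s hs => by simp [hb₀z s hs], fun s => by simpa using hZn s, fun s => by simpa using hZb s,
    fun s => by simpa using hZw s, fun s hs => ?_, fun s hs => ?_⟩
  · rw [contDiff_infty_iff_deriv]
    refine ⟨fun s => (hηd s).differentiableAt, ?_⟩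
    rw [funext fun s => (hηd s).deriv]
    exact hws
  · simp [hw1 s hs, hZz s (hs.trans (le_abs_self s))]
  · simp [hwm1 s hs, hZz s ((by linarith : 1 ≤ -s).trans (neg_le_abs s))]

end Kink

/-! ### Arbitrarily small positive smooth functions on a noncompact manifold. -/

section SmallFunction

variable {n : ℕ} {F : Type*} [TopologicalSpace F] [T2Space F] [SecondCountableTopology F]
  [ChartedSpace (EuclideanSpace ℝ (Fin n)) F] [IsManifold (𝓡 n) ∞ F]

/-- Only local boundedness is asked of `q`, because it is applied to the reciprocal of a bound `ε`
that may jump. -/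
theorem IsCompact.exists_bound_of_local {K : Set F} (hK : IsCompact K) {q : F → ℝ}
    (hq : ∀ p, ∃ C, ∀ᶠ x in 𝓝 p, q x ≤ C) : ∃ C, ∀ x ∈ K, q x ≤ C := by
  refine hK.induction_on (p := fun s => ∃ C, ∀ x ∈ s, q x ≤ C) ⟨0, by simp⟩ ?_ ?_ ?_
  · rintro s t hst ⟨C, hC⟩
    exact ⟨C, fun x hx => hC x (hst hx)⟩
  · rintro s t ⟨C, hC⟩ ⟨C', hC'⟩
    exact ⟨max C C', fun x hx => hx.elim (fun h => (hC x h).trans (le_max_left _ _))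
      fun h => (hC' x h).trans (le_max_right _ _)⟩
  · intro x _
    obtain ⟨C, hC⟩ := hq x
    exact ⟨_, mem_nhdsWithin_of_mem_nhds hC, C, fun y hy => hy⟩

/-- There are positive smooth functions that are arbitrarily small with respect to a local,
sublinear, locally bounded quantity `D`. -/
theorem exists_small_smooth_pos (D : (F → ℝ) → F → ℝ) (ε : F → ℝ)
    (hadd : ∀ a b : F → ℝ, ContMDiff (𝓡 n) 𝓘(ℝ, ℝ) ∞ a → ContMDiff (𝓡 n) 𝓘(ℝ, ℝ) ∞ b →
      ∀ p, D (a + b) p ≤ D a p + D b p)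
    (hsmul : ∀ (c : ℝ) (a : F → ℝ), 0 ≤ c → ContMDiff (𝓡 n) 𝓘(ℝ, ℝ) ∞ a →
      ∀ p, D (c • a) p ≤ c * D a p)
    (hcongr : ∀ (a b : F → ℝ) (p : F), a =ᶠ[𝓝 p] b → D a p = D b p)
    (hbdd : ∀ a : F → ℝ, ContMDiff (𝓡 n) 𝓘(ℝ, ℝ) ∞ a → ∀ p, ∃ C, ∀ᶠ x in 𝓝 p, D a x ≤ C)
    (hε : ∀ p, ∃ c > 0, ∀ᶠ x in 𝓝 p, c ≤ ε x) :
    ∃ δ : F → ℝ, ContMDiff (𝓡 n) 𝓘(ℝ, ℝ) ∞ δ ∧ (∀ p, 0 < δ p) ∧ ∀ p, D δ p ≤ ε p := by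
  have : LocallyCompactSpace F := ChartedSpace.locallyCompactSpace (EuclideanSpace ℝ (Fin n)) F
  have hεpos : ∀ p, 0 < ε p := fun p => by
    obtain ⟨c, hc, h⟩ := hε p
    exact hc.trans_le h.self_of_nhds
  have hD0 : ∀ p, D 0 p ≤ 0 := fun p => by
    simpa using hsmul 0 0 le_rfl contMDiff_const p
  obtain ⟨ι, ρ, -⟩ := SmoothBumpCovering.exists_isSubordinate (𝓡 n) (s := (univ : Set F))
    isClosed_univ (U := fun _ => univ) (fun _ _ => univ_mem)
  have hcount : Countable ι := by
    rw [← Set.countable_univ_iff]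
    exact ρ.locallyFinite.countable_univ fun i => ⟨ρ.c i, by simp⟩
  let _ := Encodable.ofCountable ι
  have hρs : ∀ i, ContMDiff (𝓡 n) 𝓘(ℝ, ℝ) ∞ (ρ i) := fun i => (ρ i).contMDiff
  have hB : ∀ i, ∃ B, 0 < B ∧ ∀ x ∈ tsupport (ρ i), D (ρ i) x ≤ B := fun i => by
    obtain ⟨C, hC⟩ := IsCompact.exists_bound_of_local (ρ i).hasCompactSupport (hbdd _ (hρs i))
    exact ⟨max C 1, lt_max_of_lt_right one_pos, fun x hx => (hC x hx).trans (le_max_left _ _)⟩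
  have hm : ∀ i, ∃ m, 0 < m ∧ ∀ x ∈ tsupport (ρ i), m ≤ ε x := fun i => by
    obtain ⟨C, hC⟩ := IsCompact.exists_bound_of_local (q := fun x => (ε x)⁻¹)
      (ρ i).hasCompactSupport fun p => by
        obtain ⟨c, hc, h⟩ := hε p
        exact ⟨c⁻¹, h.mono fun x hx => inv_anti₀ hc hx⟩
    refine ⟨(max C 1)⁻¹, inv_pos.2 (lt_max_of_lt_right one_pos), fun x hx => ?_⟩
    exact inv_le_of_inv_le₀ (hεpos x) ((hC x hx).trans (le_max_left _ _))
  choose B hBpos hB using hB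
  choose m hmpos hm using hm
  obtain ⟨θ, hθpos, σ, hσ, hσ1⟩ := posSumOfEncodable one_pos ι
  -- On the support of the `i`-th bump, `D` of the bump is at most `B i` and `ε` is at least `m i`,
  -- so this weight makes the `i`-th term cost at most `θ i * ε`, with the `θ i` summing to at most
  -- `1`.
  set c : ι → ℝ := fun i => θ i * m i / B i with hc
  have hcpos : ∀ i, 0 < c i := fun i => div_pos (mul_pos (hθpos i) (hmpos i)) (hBpos i)
  have hterm : ∀ i p, D (c i • ⇑(ρ i)) p ≤ θ i * ε p := fun i p => by
    refine (hsmul _ _ (hcpos i).le (hρs i) p).trans ?_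
    by_cases hp : p ∈ tsupport (ρ i)
    · calc c i * D (ρ i) p ≤ c i * B i := mul_le_mul_of_nonneg_left (hB i p hp) (hcpos i).le
        _ = θ i * m i := div_mul_cancel₀ _ (hBpos i).ne'
        _ ≤ θ i * ε p := mul_le_mul_of_nonneg_left (hm i p hp) (hθpos i).le
    · rw [hcongr _ 0 p (notMem_tsupport_iff_eventuallyEq.1 hp)]
      exact (mul_nonpos_of_nonneg_of_nonpos (hcpos i).le (hD0 p)).trans
        (mul_pos (hθpos i) (hεpos p)).le
  have hlf : LocallyFinite fun i => Function.support (c i • ⇑(ρ i)) :=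
    ρ.locallyFinite.subset fun i => Function.support_const_smul_subset _ _
  have hcs : ∀ i, ContMDiff (𝓡 n) 𝓘(ℝ, ℝ) ∞ (c i • ⇑(ρ i)) := fun i =>
    ContMDiff.mul (I := 𝓘(ℝ, ℝ)) (I' := 𝓡 n) contMDiff_const (hρs i)
  have hsum : ∀ S : Finset ι, ContMDiff (𝓡 n) 𝓘(ℝ, ℝ) ∞ (∑ i ∈ S, c i • ⇑(ρ i)) ∧
      ∀ p, D (∑ i ∈ S, c i • ⇑(ρ i)) p ≤ (∑ i ∈ S, θ i) * ε p := by
    classical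
    intro S
    induction S using Finset.induction_on with
    | empty => simpa using ⟨contMDiff_const, hD0⟩
    | insert i S hi ih =>
      rw [Finset.sum_insert hi, Finset.sum_insert hi]
      refine ⟨(hcs i).add ih.1, fun p => (hadd _ _ (hcs i) ih.1 p).trans ?_⟩
      rw [add_mul]
      exact add_le_add (hterm i p) (ih.2 p)
  refine ⟨fun p => ∑ᶠ i, (c i • ⇑(ρ i)) p, contMDiff_finsum hcs hlf, fun p => ?_, fun p => ?_⟩
  · have hfin : (Function.support fun i => (c i • ⇑(ρ i)) p).Finite := hlf.point_finite p
    refine finsum_pos (fun i => mul_nonneg (hcpos i).le (ρ i).nonneg) ?_ hfin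
    refine ⟨ρ.ind p (mem_univ p), ?_⟩
    simp only [Pi.smul_apply, ρ.apply_ind, smul_eq_mul, mul_one]
    exact hcpos _
  · obtain ⟨U, hU, hfin⟩ := hlf p
    -- Near `p` only finitely many bumps are nonzero, and `D` is local, so finite subadditivity
    -- suffices.
    have heq : (fun x => ∑ᶠ i, (c i • ⇑(ρ i)) x) =ᶠ[𝓝 p] ∑ i ∈ hfin.toFinset, c i • ⇑(ρ i) := by
      filter_upwards [hU] with x hx
      rw [Finset.sum_apply]
      refine finsum_eq_sum_of_support_subset _ fun i hi => ?_
      rw [Finite.coe_toFinset]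
      exact ⟨x, hi, hx⟩
    rw [hcongr _ _ p heq]
    refine ((hsum _).2 p).trans ?_
    have h1 : ∑ i ∈ hfin.toFinset, θ i ≤ 1 :=
      (sum_le_hasSum _ (fun i _ => (hθpos i).le) hσ).trans hσ1
    exact mul_le_of_le_one_left (hεpos p).le h1

end SmallFunction

/-! ### The sign of a defining function on the two sides of its zero set. -/

section Sides

variable {n : ℕ} {F : Type*} [TopologicalSpace F]
  [ChartedSpace (EuclideanSpace ℝ (Fin n)) F] [IsManifold (𝓡 n) ∞ F]

theorem dirDeriv_eq_fderiv_comp_chart {e : OpenPartialHomeomorph F (Euc n)}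
    (he : e ∈ atlas (Euc n) F) {u : F → ℝ}
    (hu : ContMDiff (𝓡 n) 𝓘(ℝ, ℝ) ∞ u) {p : F} (hp : p ∈ e.source)
    (v : TangentSpace (𝓡 n) p) :
    dirDeriv u p v = fderiv ℝ (u ∘ e.symm) (e p) (mfderiv (𝓡 n) (𝓡 n) e p v) := by
  have hm := atlas_mdifferentiable he
  have hd : MDifferentiableAt 𝓘(ℝ, Euc n) 𝓘(ℝ, ℝ) (u ∘ e.symm) (e p) :=
    ((contDiffAt_comp_symm he hu (e.map_source hp)).differentiableAt (by simp)).mdifferentiableAt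
  have h1 : u =ᶠ[𝓝 p] (u ∘ e.symm) ∘ e := by
    filter_upwards [e.open_source.mem_nhds hp] with q hq
    simp [e.left_inv hq]
  have h2 := h1.mfderiv_eq (I := 𝓡 n) (I' := 𝓘(ℝ, ℝ))
  have h3 := mfderiv_comp (I := 𝓡 n) (I' := 𝓡 n) (I'' := 𝓘(ℝ, ℝ)) p hd
    (hm.mdifferentiableAt hp)
  rw [mfderiv_eq_fderiv] at h3
  have h4 := h2.trans h3
  exact congrArg (fun l : Euc n →L[ℝ] ℝ => l v) h4

/-- Near a point where a smooth function vanishes and has nonzero derivative, the function is a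
coordinate of a product chart. -/
theorem exists_straightening {u : F → ℝ} (hu : ContMDiff (𝓡 n) 𝓘(ℝ, ℝ) ∞ u) {p : F}
    {v : TangentSpace (𝓡 n) p} (hv : dirDeriv u p v ≠ 0) :
    ∃ (K : Submodule ℝ (Euc n)) (Φ : OpenPartialHomeomorph F (ℝ × K)),
      p ∈ Φ.source ∧ ∀ q ∈ Φ.source, (Φ q).1 = u q := by
  set e := chartAt (Euc n) p
  have he : e ∈ atlas (Euc n) F := chart_mem_atlas _ p
  have hp : p ∈ e.source := mem_chart_source _ p
  have hs : HasStrictFDerivAt (u ∘ e.symm) (fderiv ℝ (u ∘ e.symm) (e p)) (e p) :=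
    (contDiffAt_comp_symm he hu (e.map_source hp)).hasStrictFDerivAt (by simp)
  have hr : (fderiv ℝ (u ∘ e.symm) (e p)).range = ⊤ := by
    rw [LinearMap.range_eq_top]
    refine LinearMap.surjective fun h0 => hv ?_
    rw [dirDeriv_eq_fderiv_comp_chart he hu hp]
    exact congrArg (fun l : Euc n →ₗ[ℝ] ℝ => l (mfderiv (𝓡 n) (𝓡 n) e p v)) h0
  refine ⟨_, e.trans (hs.implicitToOpenPartialHomeomorph _ _ hr), ?_, fun q hq => ?_⟩
  · rw [OpenPartialHomeomorph.trans_source]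
    exact ⟨hp, hs.mem_implicitToOpenPartialHomeomorph_source hr⟩
  · rw [OpenPartialHomeomorph.trans_source] at hq
    rw [OpenPartialHomeomorph.trans_apply, hs.implicitToOpenPartialHomeomorph_fst]
    simp [e.left_inv hq.1]

/-- Along a curve with velocity `v`, the derivative of `u` at time `0` is positive, so `u > 0` at
small positive times, when the curve is already in `S` and in `U`. -/
theorem exists_mem_of_pointsInto {u : F → ℝ} (hu : ContMDiff (𝓡 n) 𝓘(ℝ, ℝ) ∞ u) {p : F}
    {v : TangentSpace (𝓡 n) p} (hv : 0 < dirDeriv u p v) (hup : u p = 0) {S : Set F}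
    (hS : PointsInto p v S) {U : Set F} (hU : U ∈ 𝓝 p) : ∃ q ∈ S ∩ U, 0 < u q := by
  obtain ⟨γ, rfl, hγ, hγS⟩ := hS
  have hud : HasMFDerivAt (𝓡 n) 𝓘(ℝ, ℝ) u (γ 0) (mfderiv (𝓡 n) 𝓘(ℝ, ℝ) u (γ 0)) :=
    (hu.mdifferentiableAt (by simp)).hasMFDerivAt
  let L : Euc n →L[ℝ] ℝ := mfderiv (𝓡 n) 𝓘(ℝ, ℝ) u (γ 0)
  let v' : Euc n := v
  have h0 : HasFDerivAt (u ∘ γ) (L.comp ((1 : ℝ →L[ℝ] ℝ).smulRight v')) 0 :=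
    (hud.comp 0 hγ).hasFDerivAt
  have h1 : HasDerivAt (u ∘ γ) (L v') 0 := by
    have h := h0.hasDerivAt
    simpa using h
  have h2 : deriv (u ∘ γ) 0 = dirDeriv u (γ 0) v := h1.deriv
  have h3 := eventually_nhdsWithin_sign_eq_of_deriv_pos (f := u ∘ γ) (x₀ := 0)
    (by rw [h2]; exact hv) hup
  have h4 : ∀ᶠ t in 𝓝[>] (0 : ℝ), γ t ∈ U :=
    (hγ.continuousAt.eventually hU).filter_mono nhdsWithin_le_nhds
  obtain ⟨t, ht1, ht2, ht3, ht4⟩ := (hγS.and (h4.and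
    ((h3.filter_mono nhdsWithin_le_nhds).and self_mem_nhdsWithin))).exists
  refine ⟨γ t, ⟨ht1, ht2⟩, ?_⟩
  rw [sub_zero, sign_pos ht4, sign_eq_one_iff] at ht3
  exact ht3

/-- In a chart with `u` as first coordinate, each half-ball `u > 0`, `u < 0` is connected and lies
in `P ∪ M`, hence in one of the two sets; the curves given by `PointsInto` decide which. A zero of
`u` lying in `P` or `M` is excluded because both signs of `u` occur arbitrarily near it. -/
theorem exists_nhds_sign_of_pointsInto {u : F → ℝ} (hu : ContMDiff (𝓡 n) 𝓘(ℝ, ℝ) ∞ u) {p : F}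
    {v : TangentSpace (𝓡 n) p} (hv : 0 < dirDeriv u p v) (hup : u p = 0) {P M : Set F}
    (hP : IsOpen P) (hM : IsOpen M) (hdisj : Disjoint P M)
    (hsep : ∀ q, q ∉ P ∪ M → u q = 0) (hvP : PointsInto p v P) (hvM : PointsInto p (-v) M) :
    ∃ U ∈ 𝓝 p, (∀ q ∈ U ∩ P, 0 < u q) ∧ (∀ q ∈ U ∩ M, u q < 0) := by
  obtain ⟨K, Φ, hpΦ, hΦu⟩ := exists_straightening hu hv.ne'
  obtain ⟨r, hr, hball⟩ := Metric.isOpen_iff.1 Φ.open_target _ (Φ.map_source hpΦ)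
  have huΦ : ∀ z ∈ Φ.target, u (Φ.symm z) = z.1 := fun z hz => by
    rw [← hΦu _ (Φ.map_target hz), Φ.right_inv hz]
  have hUmem : Φ.source ∩ Φ ⁻¹' Metric.ball (Φ p) r ∈ 𝓝 p :=
    inter_mem (Φ.open_source.mem_nhds hpΦ)
      ((Φ.continuousAt hpΦ).preimage_mem_nhds (Metric.ball_mem_nhds _ hr))
  -- The sign `σ = ±1` treats both half-balls at once.
  have side : ∀ (σ : ℝ) (S T : Set F), IsOpen S → IsOpen T → Disjoint S T →
      (∀ q, q ∉ S ∪ T → u q = 0) →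
      (∃ q ∈ S ∩ (Φ.source ∩ Φ ⁻¹' Metric.ball (Φ p) r), 0 < σ * u q) →
      ∀ z ∈ Metric.ball (Φ p) r, 0 < σ * z.1 → Φ.symm z ∈ S := by
    rintro σ S T hS hT hST hzero ⟨q, ⟨hqS, hqs, hqb⟩, hq⟩ z hz hz1
    set A : Set (ℝ × K) := Metric.ball (Φ p) r ∩ {z | 0 < σ * z.1}
    have hl : IsLinearMap ℝ (fun z : ℝ × K => σ * z.1) :=
      ⟨fun a b => by simp [mul_add], fun c a => by simp; ring⟩
    have hA : IsPreconnected A :=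
      ((convex_ball _ _).inter (convex_halfSpace_gt hl 0)).isPreconnected
    have hA' : IsPreconnected (Φ.symm '' A) :=
      hA.image _ (Φ.continuousOn_symm.mono fun z hz => hball hz.1)
    have hqA : Φ q ∈ A := ⟨hqb, by change 0 < σ * (Φ q).1; rwa [hΦu q hqs]⟩
    have hne : (Φ.symm '' A ∩ S).Nonempty := ⟨q, ⟨Φ q, hqA, Φ.left_inv hqs⟩, hqS⟩
    have hsub : Φ.symm '' A ⊆ S ∪ T := by
      rintro _ ⟨y, hy, rfl⟩
      by_contra hn
      have h0 := hzero _ hn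
      rw [huΦ y (hball hy.1)] at h0
      have h2 : 0 < σ * y.1 := hy.2
      simp [h0] at h2
    exact hA'.subset_left_of_subset_union hS hT hST hsub hne (mem_image_of_mem _ ⟨hz, hz1⟩)
  have hpos : ∀ z ∈ Metric.ball (Φ p) r, 0 < z.1 → Φ.symm z ∈ P := by
    obtain ⟨q, hq, hq0⟩ := exists_mem_of_pointsInto hu hv hup hvP hUmem
    intro z hz hz1
    exact side 1 P M hP hM hdisj hsep ⟨q, hq, by simpa using hq0⟩ z hz (by simpa using hz1)
  have hneg : ∀ z ∈ Metric.ball (Φ p) r, z.1 < 0 → Φ.symm z ∈ M := by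
    have hun : ContMDiff (𝓡 n) 𝓘(ℝ, ℝ) ∞ (-u) := hu.neg
    have hvn : 0 < dirDeriv (-u) p (-v) := by
      have h : dirDeriv (-u) p (-v) = dirDeriv u p v := by
        rw [dirDeriv_eq_fderiv_comp_chart (chart_mem_atlas (Euc n) p) hun
          (mem_chart_source (Euc n) p), dirDeriv_eq_fderiv_comp_chart (chart_mem_atlas (Euc n) p) hu
          (mem_chart_source (Euc n) p)]
        have h1 : (-u) ∘ (chartAt (Euc n) p).symm = -(u ∘ (chartAt (Euc n) p).symm) := rfl
        rw [h1, fderiv_neg, map_neg]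
        exact (neg_apply _ _).trans ((congrArg Neg.neg (map_neg _ _)).trans (neg_neg _))
      rwa [h]
    obtain ⟨q, hq, hq0⟩ := exists_mem_of_pointsInto hun hvn (by simp [hup]) hvM hUmem
    intro z hz hz1
    exact side (-1) M P hM hP hdisj.symm (fun q hq => hsep q (by rwa [union_comm]))
      ⟨q, hq, by simpa using hq0⟩ z hz (by simpa using hz1)
  -- Moving a zero of `u` slightly along the first coordinate in the direction `σ` stays in the open
  -- set `S` and gives `u` the sign of `σ`.
  have hnear : ∀ q ∈ Φ.source ∩ Φ ⁻¹' Metric.ball (Φ p) r, u q = 0 → ∀ S : Set F, IsOpen S →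
      q ∈ S → ∀ σ : ℝ, σ ≠ 0 → ∃ z ∈ Metric.ball (Φ p) r, 0 < σ * z.1 ∧ Φ.symm z ∈ S := by
    intro q hq hq0 S hS hqS σ hσ
    have hc : ContinuousAt (fun s : ℝ => ((Φ q).1 + s * σ, (Φ q).2)) 0 := by fun_prop
    have h00 : ((Φ q).1 + 0 * σ, (Φ q).2) = Φ q := by simp
    have h1 : ∀ᶠ s : ℝ in 𝓝 0, ((Φ q).1 + s * σ, (Φ q).2) ∈ Metric.ball (Φ p) r :=
      hc.preimage_mem_nhds (by simpa only [h00] using Metric.isOpen_ball.mem_nhds hq.2)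
    have h2 : ∀ᶠ s : ℝ in 𝓝 0, Φ.symm ((Φ q).1 + s * σ, (Φ q).2) ∈ S := by
      have h3 : ContinuousAt Φ.symm ((Φ q).1 + 0 * σ, (Φ q).2) := by
        rw [h00]
        exact Φ.continuousAt_symm (Φ.map_source hq.1)
      refine (ContinuousAt.comp (f := fun s : ℝ => ((Φ q).1 + s * σ, (Φ q).2)) h3 hc).eventually ?_
      simp only [Function.comp, h00, Φ.left_inv hq.1]
      exact hS.mem_nhds hqS
    obtain ⟨s, ⟨hs1, hs2⟩, hs3⟩ := (((h1.and h2).filter_mono nhdsWithin_le_nhds).and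
      (self_mem_nhdsWithin (a := (0 : ℝ)) (s := Ioi 0))).exists
    refine ⟨_, hs1, ?_, hs2⟩
    have hs4 : 0 < s := hs3
    rw [hΦu q hq.1, hq0]
    have : 0 < s * σ ^ 2 := by positivity
    simpa using (by nlinarith : 0 < σ * (0 + s * σ))
  refine ⟨_, hUmem, fun q hq => ?_, fun q hq => ?_⟩
  · rcases lt_trichotomy (u q) 0 with h | h | h
    · have h1 := hneg (Φ q) hq.1.2 (by rwa [hΦu q hq.1.1])
      rw [Φ.left_inv hq.1.1] at h1
      exact (disjoint_left.1 hdisj hq.2 h1).elim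
    · obtain ⟨z, hz, hz1, hz2⟩ := hnear q hq.1 h P hP hq.2 (-1) (by norm_num)
      exact (disjoint_left.1 hdisj hz2 (hneg z hz (by linarith))).elim
    · exact h
  · rcases lt_trichotomy (u q) 0 with h | h | h
    · exact h
    · obtain ⟨z, hz, hz1, hz2⟩ := hnear q hq.1 h M hM hq.2 1 (by norm_num)
      exact (disjoint_left.1 hdisj (hpos z hz (by linarith)) hz2).elim
    · have h1 := hpos (Φ q) hq.1.2 (by rwa [hΦu q hq.1.1])
      rw [Φ.left_inv hq.1.1] at h1
      exact (disjoint_left.1 hdisj h1 hq.2).elim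

end Sides

/-! ### Sum, product and chain rules for the Laplacian and the gradient product. -/

section Calculus

variable {n : ℕ} {F : Type*} [TopologicalSpace F]
  [ChartedSpace (EuclideanSpace ℝ (Fin n)) F] [IsManifold (𝓡 n) ∞ F]
  (g : SmoothMetric n F)

theorem laplacian_eq_formTrace {a : F → ℝ} (ha : ContMDiff (𝓡 n) 𝓘(ℝ, ℝ) ∞ a) (p : F) :
    laplacian g a p = formTrace (chartMetric g (chartAt (Euc n) p) (chartAt (Euc n) p p))
      (chartHessian g (chartAt (Euc n) p) a (chartAt (Euc n) p p)) :=
  laplacianInChart_eq_formTrace g _ (contDiffAt_comp_symm (chart_mem_atlas _ p) ha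
    (mem_chart_target _ p))

theorem comp_symm_eventuallyEq_of_eventuallyEq {e : OpenPartialHomeomorph F (Euc n)} {a b : F → ℝ}
    {p : F} (hp : p ∈ e.source) (h : a =ᶠ[𝓝 p] b) : a ∘ e.symm =ᶠ[𝓝 (e p)] b ∘ e.symm := by
  have hc := e.continuousAt_symm (e.map_source hp)
  rw [ContinuousAt, e.left_inv hp] at hc
  exact hc.eventually h

theorem laplacian_congr {a b : F → ℝ} {p : F} (h : a =ᶠ[𝓝 p] b) :
    laplacian g a p = laplacian g b p := by
  have h1 := comp_symm_eventuallyEq_of_eventuallyEq (mem_chart_source (Euc n) p) h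
  have h2 : ∀ j, pderiv j (a ∘ (chartAt (Euc n) p).symm)
      =ᶠ[𝓝 (chartAt (Euc n) p p)] pderiv j (b ∘ (chartAt (Euc n) p).symm) := fun j =>
    (h1.fderiv (𝕜 := ℝ)).mono fun z hz => by simp only [pderiv, hz]
  have h3 : ∀ i j, pderiv i (pderiv j (a ∘ (chartAt (Euc n) p).symm)) (chartAt (Euc n) p p)
      = pderiv i (pderiv j (b ∘ (chartAt (Euc n) p).symm)) (chartAt (Euc n) p p) := fun i j => by
    simp only [pderiv.eq_1 i, (h2 j).fderiv_eq]
  simp only [laplacian, laplacianInChart, h3, fun j => (h2 j).self_of_nhds]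

theorem conformalLaplacian_congr {a b : F → ℝ} {p : F} (h : a =ᶠ[𝓝 p] b) :
    conformalLaplacian g a p = conformalLaplacian g b p := by
  rw [conformalLaplacian, conformalLaplacian, laplacian_congr g h, h.self_of_nhds]

theorem gradInner_congr_right (a : F → ℝ) {b c : F → ℝ} {p : F} (h : b =ᶠ[𝓝 p] c) :
    gradInner g a b p = gradInner g a c p := by
  have h1 := comp_symm_eventuallyEq_of_eventuallyEq (mem_chart_source (Euc n) p) h
  rw [gradInner, gradInner, gradInnerInChart, gradInnerInChart, h1.fderiv_eq]

section Chart

variable {e : OpenPartialHomeomorph F (Euc n)} {a b : F → ℝ} {y : Euc n}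

theorem differentiableAt_comp_symm (he : e ∈ atlas (Euc n) F)
    (ha : ContMDiff (𝓡 n) 𝓘(ℝ, ℝ) ∞ a) (hy : y ∈ e.target) :
    DifferentiableAt ℝ (a ∘ e.symm) y :=
  (contDiffAt_comp_symm he ha hy).differentiableAt (by simp)

theorem differentiableAt_fderiv_comp_symm (he : e ∈ atlas (Euc n) F)
    (ha : ContMDiff (𝓡 n) 𝓘(ℝ, ℝ) ∞ a) (hy : y ∈ e.target) :
    DifferentiableAt ℝ (fderiv ℝ (a ∘ e.symm)) y :=
  ((contDiffAt_comp_symm he ha hy).fderiv_right (m := 1) (by norm_cast)).differentiableAt (by simp)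

theorem fderiv_add_comp_symm (he : e ∈ atlas (Euc n) F) (ha : ContMDiff (𝓡 n) 𝓘(ℝ, ℝ) ∞ a)
    (hb : ContMDiff (𝓡 n) 𝓘(ℝ, ℝ) ∞ b) (hy : y ∈ e.target) :
    fderiv ℝ ((a + b) ∘ e.symm) y = fderiv ℝ (a ∘ e.symm) y + fderiv ℝ (b ∘ e.symm) y :=
  fderiv_add (differentiableAt_comp_symm he ha hy) (differentiableAt_comp_symm he hb hy)

theorem fderiv_mul_comp_symm (he : e ∈ atlas (Euc n) F) (ha : ContMDiff (𝓡 n) 𝓘(ℝ, ℝ) ∞ a)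
    (hb : ContMDiff (𝓡 n) 𝓘(ℝ, ℝ) ∞ b) (hy : y ∈ e.target) :
    fderiv ℝ ((a * b) ∘ e.symm) y = (a ∘ e.symm) y • fderiv ℝ (b ∘ e.symm) y
      + (b ∘ e.symm) y • fderiv ℝ (a ∘ e.symm) y :=
  fderiv_mul (differentiableAt_comp_symm he ha hy) (differentiableAt_comp_symm he hb hy)

theorem fderiv_scomp_comp_symm (he : e ∈ atlas (Euc n) F) (ha : ContMDiff (𝓡 n) 𝓘(ℝ, ℝ) ∞ a)
    {ψ ψ' : ℝ → ℝ} (hψ : ∀ s, HasDerivAt ψ (ψ' s) s) (hy : y ∈ e.target) :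
    fderiv ℝ ((ψ ∘ a) ∘ e.symm) y = ψ' ((a ∘ e.symm) y) • fderiv ℝ (a ∘ e.symm) y :=
  ((hψ _).comp_hasFDerivAt y (differentiableAt_comp_symm he ha hy).hasFDerivAt).fderiv

theorem chartHessian_add (he : e ∈ atlas (Euc n) F) (ha : ContMDiff (𝓡 n) 𝓘(ℝ, ℝ) ∞ a)
    (hb : ContMDiff (𝓡 n) 𝓘(ℝ, ℝ) ∞ b) (hy : y ∈ e.target) :
    chartHessian g e (a + b) y = chartHessian g e a y + chartHessian g e b y := by
  have h : fderiv ℝ ((a + b) ∘ e.symm) =ᶠ[𝓝 y]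
      fun z => fderiv ℝ (a ∘ e.symm) z + fderiv ℝ (b ∘ e.symm) z := by
    filter_upwards [e.open_target.mem_nhds hy] with z hz
    exact fderiv_add_comp_symm he ha hb hz
  have h2 := (differentiableAt_fderiv_comp_symm he ha hy).hasFDerivAt.add
    (differentiableAt_fderiv_comp_symm he hb hy).hasFDerivAt
  ext u v
  rw [_root_.add_apply, _root_.add_apply, chartHessian_apply, chartHessian_apply,
    chartHessian_apply, h.fderiv_eq, fderiv_add_comp_symm he ha hb hy]
  erw [h2.fderiv]
  simp
  ring

theorem chartHessian_mul (he : e ∈ atlas (Euc n) F) (ha : ContMDiff (𝓡 n) 𝓘(ℝ, ℝ) ∞ a)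
    (hb : ContMDiff (𝓡 n) 𝓘(ℝ, ℝ) ∞ b) (hy : y ∈ e.target) :
    chartHessian g e (a * b) y = (a ∘ e.symm) y • chartHessian g e b y
      + (b ∘ e.symm) y • chartHessian g e a y
      + (tensorForm (fderiv ℝ (a ∘ e.symm) y) (fderiv ℝ (b ∘ e.symm) y)
        + tensorForm (fderiv ℝ (b ∘ e.symm) y) (fderiv ℝ (a ∘ e.symm) y)) := by
  have h : fderiv ℝ ((a * b) ∘ e.symm) =ᶠ[𝓝 y] fun z => (a ∘ e.symm) z • fderiv ℝ (b ∘ e.symm) z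
      + (b ∘ e.symm) z • fderiv ℝ (a ∘ e.symm) z := by
    filter_upwards [e.open_target.mem_nhds hy] with z hz
    exact fderiv_mul_comp_symm he ha hb hz
  have h1a := (differentiableAt_comp_symm he ha hy).hasFDerivAt
  have h1b := (differentiableAt_comp_symm he hb hy).hasFDerivAt
  have h2a := (differentiableAt_fderiv_comp_symm he ha hy).hasFDerivAt
  have h2b := (differentiableAt_fderiv_comp_symm he hb hy).hasFDerivAt
  have h3 : HasFDerivAt (fun z => (a ∘ e.symm) z • fderiv ℝ (b ∘ e.symm) z
      + (b ∘ e.symm) z • fderiv ℝ (a ∘ e.symm) z) _ y := (h1a.smul h2b).add (h1b.smul h2a)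
  ext u v
  simp only [_root_.add_apply, _root_.smul_apply, tensorForm_apply]
  rw [chartHessian_apply, chartHessian_apply, chartHessian_apply, h.fderiv_eq, h3.fderiv,
    fderiv_mul_comp_symm he ha hb hy]
  simp
  ring

theorem chartHessian_scomp (he : e ∈ atlas (Euc n) F) (ha : ContMDiff (𝓡 n) 𝓘(ℝ, ℝ) ∞ a)
    {ψ ψ' ψ'' : ℝ → ℝ} (hψ : ∀ s, HasDerivAt ψ (ψ' s) s) (hψ' : ∀ s, HasDerivAt ψ' (ψ'' s) s)
    (hy : y ∈ e.target) :
    chartHessian g e (ψ ∘ a) y = ψ' ((a ∘ e.symm) y) • chartHessian g e a y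
      + ψ'' ((a ∘ e.symm) y) •
        tensorForm (fderiv ℝ (a ∘ e.symm) y) (fderiv ℝ (a ∘ e.symm) y) := by
  have h : fderiv ℝ ((ψ ∘ a) ∘ e.symm) =ᶠ[𝓝 y]
      fun z => ψ' ((a ∘ e.symm) z) • fderiv ℝ (a ∘ e.symm) z := by
    filter_upwards [e.open_target.mem_nhds hy] with z hz
    exact fderiv_scomp_comp_symm he ha hψ hz
  have h1 : HasFDerivAt (fun z => ψ' ((a ∘ e.symm) z))
      (ψ'' ((a ∘ e.symm) y) • fderiv ℝ (a ∘ e.symm) y) y :=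
    (hψ' _).comp_hasFDerivAt y (differentiableAt_comp_symm he ha hy).hasFDerivAt
  have h2 := (differentiableAt_fderiv_comp_symm he ha hy).hasFDerivAt
  have h3 : HasFDerivAt (fun z => ψ' ((a ∘ e.symm) z) • fderiv ℝ (a ∘ e.symm) z) _ y := h1.smul h2
  ext u v
  simp only [_root_.add_apply, _root_.smul_apply, tensorForm_apply]
  rw [chartHessian_apply, chartHessian_apply, h.fderiv_eq, h3.fderiv,
    fderiv_scomp_comp_symm he ha hψ hy]
  simp
  ring

end Chart

variable {a b : F → ℝ}

theorem comp_symm_chartAt (a : F → ℝ) (p : F) :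
    (a ∘ (chartAt (Euc n) p).symm) (chartAt (Euc n) p p) = a p := by
  simp

theorem laplacian_add (ha : ContMDiff (𝓡 n) 𝓘(ℝ, ℝ) ∞ a) (hb : ContMDiff (𝓡 n) 𝓘(ℝ, ℝ) ∞ b)
    (p : F) : laplacian g (a + b) p = laplacian g a p + laplacian g b p := by
  rw [laplacian_eq_formTrace g (ha.add hb), laplacian_eq_formTrace g ha,
    laplacian_eq_formTrace g hb,
    chartHessian_add g (chart_mem_atlas _ p) ha hb (mem_chart_target _ p), formTrace_add]

theorem gradInner_comm (a b : F → ℝ) (p : F) : gradInner g a b p = gradInner g b a p :=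
  formTrace_tensor_comm (chartMetric_symm g _ _) _ _

theorem laplacian_mul (ha : ContMDiff (𝓡 n) 𝓘(ℝ, ℝ) ∞ a) (hb : ContMDiff (𝓡 n) 𝓘(ℝ, ℝ) ∞ b)
    (p : F) : laplacian g (a * b) p = a p * laplacian g b p + b p * laplacian g a p
      + 2 * gradInner g a b p := by
  rw [laplacian_eq_formTrace g (ha.mul hb), laplacian_eq_formTrace g ha,
    laplacian_eq_formTrace g hb,
    chartHessian_mul g (chart_mem_atlas _ p) ha hb (mem_chart_target _ p), formTrace_add,
    formTrace_add, formTrace_add, formTrace_smul, formTrace_smul, comp_symm_chartAt,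
    comp_symm_chartAt]
  have h1 : gradInner g a b p = formTrace _ _ := rfl
  have h2 : gradInner g b a p = formTrace _ _ := rfl
  rw [← h1, ← h2, gradInner_comm g b a]
  ring

theorem laplacian_scomp (ha : ContMDiff (𝓡 n) 𝓘(ℝ, ℝ) ∞ a) {ψ ψ' ψ'' : ℝ → ℝ}
    (hψs : ContDiff ℝ ∞ ψ) (hψ : ∀ s, HasDerivAt ψ (ψ' s) s)
    (hψ' : ∀ s, HasDerivAt ψ' (ψ'' s) s) (p : F) :
    laplacian g (ψ ∘ a) p = ψ' (a p) * laplacian g a p + ψ'' (a p) * gradInner g a a p := by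
  rw [laplacian_eq_formTrace g (hψs.contMDiff.comp ha), laplacian_eq_formTrace g ha,
    chartHessian_scomp g (chart_mem_atlas _ p) ha hψ hψ' (mem_chart_target _ p), formTrace_add,
    formTrace_smul, formTrace_smul, comp_symm_chartAt]
  rfl

theorem tensorForm_add_right (l m m' : Euc n →L[ℝ] ℝ) :
    tensorForm l (m + m') = tensorForm l m + tensorForm l m' := by
  ext u v
  simp [tensorForm_apply, mul_add]

theorem tensorForm_smul_right (l m : Euc n →L[ℝ] ℝ) (c : ℝ) :
    tensorForm l (c • m) = c • tensorForm l m := by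
  ext u v
  simp [tensorForm_apply]
  ring

theorem gradInner_add_right (c : F → ℝ) (ha : ContMDiff (𝓡 n) 𝓘(ℝ, ℝ) ∞ a)
    (hb : ContMDiff (𝓡 n) 𝓘(ℝ, ℝ) ∞ b) (p : F) :
    gradInner g c (a + b) p = gradInner g c a p + gradInner g c b p := by
  rw [gradInner, gradInnerInChart, fderiv_add_comp_symm (chart_mem_atlas _ p) ha hb
    (mem_chart_target _ p), tensorForm_add_right, formTrace_add]
  rfl

theorem gradInner_mul_right (c : F → ℝ) (ha : ContMDiff (𝓡 n) 𝓘(ℝ, ℝ) ∞ a)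
    (hb : ContMDiff (𝓡 n) 𝓘(ℝ, ℝ) ∞ b) (p : F) :
    gradInner g c (a * b) p = a p * gradInner g c b p + b p * gradInner g c a p := by
  rw [gradInner, gradInnerInChart, fderiv_mul_comp_symm (chart_mem_atlas _ p) ha hb
    (mem_chart_target _ p), tensorForm_add_right, formTrace_add, tensorForm_smul_right,
    tensorForm_smul_right, formTrace_smul, formTrace_smul, comp_symm_chartAt, comp_symm_chartAt]
  rfl

theorem gradInner_scomp_right (c : F → ℝ) (ha : ContMDiff (𝓡 n) 𝓘(ℝ, ℝ) ∞ a) {ψ ψ' : ℝ → ℝ}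
    (hψ : ∀ s, HasDerivAt ψ (ψ' s) s) (p : F) :
    gradInner g c (ψ ∘ a) p = ψ' (a p) * gradInner g c a p := by
  rw [gradInner, gradInnerInChart, fderiv_scomp_comp_symm (chart_mem_atlas _ p) ha hψ
    (mem_chart_target _ p), tensorForm_smul_right, formTrace_smul, comp_symm_chartAt]
  rfl

theorem gradInner_self_nonneg (a : F → ℝ) (p : F) : 0 ≤ gradInner g a a p :=
  formTrace_tensor_self_nonneg (chartMetric_symm g _ _)
    (fun _ hv => chartMetric_pos g (chart_mem_atlas _ p) (mem_chart_target _ p) hv) _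

theorem gradInner_self_pos (ha : ContMDiff (𝓡 n) 𝓘(ℝ, ℝ) ∞ a) {p : F} {v : TangentSpace (𝓡 n) p}
    (hv : dirDeriv a p v ≠ 0) : 0 < gradInner g a a p := by
  refine formTrace_tensor_self_pos (chartMetric_symm g _ _)
    (fun _ hv => chartMetric_pos g (chart_mem_atlas _ p) (mem_chart_target _ p) hv) fun h => hv ?_
  rw [dirDeriv_eq_fderiv_comp_chart (chart_mem_atlas (Euc n) p) ha (mem_chart_source _ p), h]
  rfl

theorem dirDeriv_add (ha : ContMDiff (𝓡 n) 𝓘(ℝ, ℝ) ∞ a) (hb : ContMDiff (𝓡 n) 𝓘(ℝ, ℝ) ∞ b)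
    (p : F) (v : TangentSpace (𝓡 n) p) : dirDeriv (a + b) p v = dirDeriv a p v + dirDeriv b p v := by
  have he := chart_mem_atlas (Euc n) p
  have hp := mem_chart_source (Euc n) p
  rw [dirDeriv_eq_fderiv_comp_chart he (ha.add hb) hp, dirDeriv_eq_fderiv_comp_chart he ha hp,
    dirDeriv_eq_fderiv_comp_chart he hb hp, fderiv_add_comp_symm he ha hb (mem_chart_target _ p)]
  rfl

theorem dirDeriv_mul (ha : ContMDiff (𝓡 n) 𝓘(ℝ, ℝ) ∞ a) (hb : ContMDiff (𝓡 n) 𝓘(ℝ, ℝ) ∞ b)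
    (p : F) (v : TangentSpace (𝓡 n) p) :
    dirDeriv (a * b) p v = a p * dirDeriv b p v + b p * dirDeriv a p v := by
  have he := chart_mem_atlas (Euc n) p
  have hp := mem_chart_source (Euc n) p
  rw [dirDeriv_eq_fderiv_comp_chart he (ha.mul hb) hp, dirDeriv_eq_fderiv_comp_chart he ha hp,
    dirDeriv_eq_fderiv_comp_chart he hb hp, fderiv_mul_comp_symm he ha hb (mem_chart_target _ p),
    comp_symm_chartAt, comp_symm_chartAt]
  rfl

end Calculus

/-! ### The conformal Laplacian of the rounded minimum. -/

section Glue

variable {n : ℕ} {F : Type*} [TopologicalSpace F]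
  [ChartedSpace (EuclideanSpace ℝ (Fin n)) F] [IsManifold (𝓡 n) ∞ F]
  (g : SmoothMetric n F)

/-- With `L` the conformal Laplacian and `Z = s w - η(s)`, the terms in `Δs` and `⟨∇(fδ), ∇s⟩` agree
in `L (fδ η(s))` and `w L (fδ s)`. Their difference is `-Z L (fδ) + fδ b |∇s|²`, and expanding `L
(fδ)` by the product rule gives the identity. -/
theorem conformalLaplacian_glue {f δ s : F → ℝ} (hf : ContMDiff (𝓡 n) 𝓘(ℝ, ℝ) ∞ f)
    (hδ : ContMDiff (𝓡 n) 𝓘(ℝ, ℝ) ∞ δ) (hs : ContMDiff (𝓡 n) 𝓘(ℝ, ℝ) ∞ s) {η w b : ℝ → ℝ}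
    (hη : ContDiff ℝ ∞ η) (hηw : ∀ s, HasDerivAt η (w s) s) (hwb : ∀ s, HasDerivAt w (-b s) s)
    (p : F) :
    conformalLaplacian g (f + f * δ * (η ∘ s)) p =
      (1 - w (s p) - (s p * w (s p) - η (s p)) * δ p) * conformalLaplacian g f p
      + w (s p) * conformalLaplacian g (f + f * δ * s) p
      + (s p * w (s p) - η (s p)) * (f p * laplacian g δ p + 2 * gradInner g f δ p)
      + f p * δ p * b (s p) * gradInner g s s p := by
  have hq := hf.mul hδ
  have hηs : ContMDiff (𝓡 n) 𝓘(ℝ, ℝ) ∞ (η ∘ s) := hη.contMDiff.comp hs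
  simp only [conformalLaplacian]
  rw [laplacian_add g hf (hq.mul hηs), laplacian_add g hf (hq.mul hs), laplacian_mul g hq hηs,
    laplacian_mul g hq hs, laplacian_mul g hf hδ, laplacian_scomp g hs hη hηw hwb,
    gradInner_scomp_right g _ hs hηw]
  simp only [Pi.add_apply, Pi.mul_apply, Function.comp]
  ring

/-- From `δ ∇s = ∇(δ s) - s ∇δ`, expand the square and drop `s² |∇δ|² ≥ 0`. This bounds `|∇s|` below
by quantities of `δ s`, the fixed function `r`, in the transition zone. -/
theorem gradInner_mul_self_le {δ s : F → ℝ} (hδ : ContMDiff (𝓡 n) 𝓘(ℝ, ℝ) ∞ δ)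
    (hs : ContMDiff (𝓡 n) 𝓘(ℝ, ℝ) ∞ s) {p : F} (hsp : |s p| ≤ 1) :
    gradInner g (δ * s) (δ * s) p - 2 * |gradInner g (δ * s) δ p| ≤
      δ p ^ 2 * gradInner g s s p := by
  have h1 := gradInner_mul_right g (δ * s) hδ hs p
  have h2 := gradInner_mul_right g δ hδ hs p
  have h3 := gradInner_mul_right g s hδ hs p
  have h4 := gradInner_comm g (δ * s) s p
  have h5 := gradInner_comm g (δ * s) δ p
  have h6 := gradInner_comm g s δ p
  have h7 : δ p ^ 2 * gradInner g s s p = gradInner g (δ * s) (δ * s) p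
      - 2 * (s p * gradInner g (δ * s) δ p) + s p ^ 2 * gradInner g δ δ p := by
    rw [h1, h4, h5, h3, h2, h6]
    ring
  have h8 : s p * gradInner g (δ * s) δ p ≤ |gradInner g (δ * s) δ p| := by
    refine (le_abs_self _).trans ?_
    rw [abs_mul]
    exact mul_le_of_le_one_left (abs_nonneg _) hsp
  have h9 := mul_nonneg (sq_nonneg (s p)) (gradInner_self_nonneg g δ p)
  linarith

/-- `Z ≤ 1 - w` and `δ < 1` keep the coefficient of `L f` nonnegative. `Z ≤ b` lets the concavity
term dominate the error, also where `b` is arbitrarily small. For `|s| ≥ 1` both of these last terms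
vanish. -/
theorem conformalLaplacian_glue_pos {f δ s : F → ℝ} (hf : ContMDiff (𝓡 n) 𝓘(ℝ, ℝ) ∞ f)
    (hδ : ContMDiff (𝓡 n) 𝓘(ℝ, ℝ) ∞ δ) (hs : ContMDiff (𝓡 n) 𝓘(ℝ, ℝ) ∞ s) {η w b : ℝ → ℝ}
    (hη : ContDiff ℝ ∞ η) (hηw : ∀ s, HasDerivAt η (w s) s) (hwb : ∀ s, HasDerivAt w (-b s) s)
    (hw0 : ∀ s, 0 ≤ w s) (hb1 : ∀ s, 1 ≤ |s| → b s = 0)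
    (hZ0 : ∀ s, 0 ≤ s * w s - η s) (hZb : ∀ s, s * w s - η s ≤ b s)
    (hZw : ∀ s, s * w s - η s ≤ 1 - w s) {p : F} (hfp : 0 < f p) (hδ0 : 0 < δ p) (hδ1 : δ p < 1)
    (hL : 0 < conformalLaplacian g f p) (hL' : 0 < conformalLaplacian g (f + f * δ * s) p)
    (hsmall : |laplacian g δ p| + 2 * |gradInner g f δ p| / f p + 2 * |gradInner g (δ * s) δ p|
      ≤ gradInner g (δ * s) (δ * s) p) :
    0 < conformalLaplacian g (f + f * δ * (η ∘ s)) p := by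
  rw [conformalLaplacian_glue g hf hδ hs hη hηw hwb p]
  have h0 := hZ0 (s p)
  have h1 := hZb (s p)
  have h2 := hZw (s p)
  have h3 := hw0 (s p)
  have h4 := hb1 (s p)
  set Z := s p * w (s p) - η (s p)
  set W := w (s p)
  set β := b (s p)
  have hmain : 0 < (1 - W - Z * δ p) * conformalLaplacian g f p
      + W * conformalLaplacian g (f + f * δ * s) p := by
    have h5 : (1 - δ p) * (1 - W) ≤ 1 - W - Z * δ p := by nlinarith
    -- The two coefficients never vanish together: if `w = 0`, that of `L f` is at least `1 - δ >
    -- 0`.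
    rcases h3.eq_or_lt with h6 | h6
    · rw [← h6] at h5 ⊢
      have h7 : 0 < 1 - 0 - Z * δ p := lt_of_lt_of_le (by linarith) h5
      rw [zero_mul, add_zero]
      exact mul_pos h7 hL
    · have h7 : 0 ≤ 1 - W - Z * δ p :=
        (mul_nonneg (by linarith) (by linarith)).trans h5
      exact add_pos_of_nonneg_of_pos (mul_nonneg h7 hL.le) (mul_pos h6 hL')
  have hrest : 0 ≤ Z * (f p * laplacian g δ p + 2 * gradInner g f δ p)
      + f p * δ p * β * gradInner g s s p := by
    rcases le_or_gt 1 |s p| with h5 | h5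
    · have h6 : Z = 0 := le_antisymm (h1.trans_eq (h4 h5)) h0
      rw [h6, h4 h5]
      simp
    · have hss := gradInner_self_nonneg g s p
      have h6 := gradInner_mul_self_le g hδ hs h5.le
      set X := f p * laplacian g δ p + 2 * gradInner g f δ p with hX
      have h7 : |X| ≤ f p * (δ p ^ 2 * gradInner g s s p) := by
        have h8 : |X| ≤ f p * (|laplacian g δ p| + 2 * |gradInner g f δ p| / f p) := by
          have h9 : f p * (|laplacian g δ p| + 2 * |gradInner g f δ p| / f p)
              = f p * |laplacian g δ p| + 2 * |gradInner g f δ p| := by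
            field_simp
          rw [h9, hX]
          refine (abs_add_le _ _).trans_eq ?_
          rw [abs_mul, abs_mul, abs_of_pos hfp, abs_two]
        exact h8.trans (mul_le_mul_of_nonneg_left (by linarith) hfp.le)
      -- `δ ^ 2 ≤ δ`, since `0 < δ < 1`.
      have h8 : f p * (δ p ^ 2 * gradInner g s s p) ≤ f p * (δ p * gradInner g s s p) := by
        refine mul_le_mul_of_nonneg_left (mul_le_mul_of_nonneg_right ?_ hss) hfp.le
        nlinarith
      have h9 : Z * |X| ≤ β * (f p * (δ p * gradInner g s s p)) :=
        mul_le_mul h1 (h7.trans h8) (abs_nonneg _) (h0.trans h1)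
      have h10 := mul_le_mul_of_nonneg_left (neg_abs_le X) h0
      nlinarith
  linarith

end Glue

/-! ### The choice of the width `δ` and the pasting. -/

section Main

variable {n : ℕ} {F : Type*} [TopologicalSpace F]

/-- The bound jumps at the boundary of `C`. Since `C` is closed, a point off it has a neighbourhood
where the value is `1`, so a local positive lower bound survives. -/
theorem exists_lower_bound_ite {C : Set F} (hC : IsClosed C) {h : F → ℝ} (hh : Continuous h)
    (hpos : ∀ p ∈ C, 0 < h p) [DecidablePred (· ∈ C)] (p : F) :
    ∃ c > 0, ∀ᶠ x in 𝓝 p, c ≤ if x ∈ C then h x else 1 := by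
  by_cases hp : p ∈ C
  · refine ⟨min (h p / 2) 1, lt_min (half_pos (hpos p hp)) one_pos, ?_⟩
    filter_upwards [hh.continuousAt.eventually (lt_mem_nhds (half_lt_self (hpos p hp)))] with x hx
    split_ifs
    · exact (min_le_left _ _).trans hx.le
    · exact min_le_right _ _
  · refine ⟨1, one_pos, ?_⟩
    filter_upwards [hC.isOpen_compl.mem_nhds hp] with x hx
    rw [if_neg hx]

variable [ChartedSpace (EuclideanSpace ℝ (Fin n)) F] [IsManifold (𝓡 n) ∞ F]

/-- A small positive function adapted to a hypersurface on which `r` vanishes transversally: the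
gluing estimate holds on the closed set `C`, and `δ < |r|` on the closed set `A`. -/
theorem exists_gluing_width [T2Space F] [SecondCountableTopology F] (g : SmoothMetric n F)
    {f r : F → ℝ} (hf : ContMDiff (𝓡 n) 𝓘(ℝ, ℝ) ∞ f) (hr : ContMDiff (𝓡 n) 𝓘(ℝ, ℝ) ∞ r)
    (hfpos : ∀ p, 0 < f p) {A C : Set F} (hA : IsClosed A) (hC : IsClosed C)
    (hAr : ∀ p ∈ A, r p ≠ 0) (hCr : ∀ p ∈ C, 0 < gradInner g r r p) :
    ∃ δ : F → ℝ, ContMDiff (𝓡 n) 𝓘(ℝ, ℝ) ∞ δ ∧ (∀ p, 0 < δ p) ∧ (∀ p, δ p < 1) ∧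
      (∀ p ∈ A, δ p < |r p|) ∧
      ∀ p ∈ C, |laplacian g δ p| + 2 * |gradInner g f δ p| / f p + 2 * |gradInner g r δ p|
        ≤ gradInner g r r p := by
  classical
  -- The summand `|a p|` makes a bound on `D δ` control the size of `δ` as well as its derivatives.
  set D : (F → ℝ) → F → ℝ := fun a p => |a p| + (|laplacian g a p|
    + 2 * |gradInner g f a p| / f p + 2 * |gradInner g r a p|) with hD
  -- The three entries yield, in turn, `δ < 1`, the gluing estimate on `C`, and `δ < |r|` on `A`;
  -- the halves make the inequalities strict.
  set ε : F → ℝ := fun p => min (1 / 2) (min (if p ∈ C then gradInner g r r p else 1)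
    (if p ∈ A then |r p| / 2 else 1)) with hε
  have hlap_smul : ∀ (c : ℝ) (a : F → ℝ), ContMDiff (𝓡 n) 𝓘(ℝ, ℝ) ∞ a → ∀ p,
      laplacian g (c • a) p = c * laplacian g a p := fun c a ha p => by
    have h := laplacian_scomp g (ψ := fun s => c * s) (ψ' := fun _ => c) (ψ'' := fun _ => 0) ha
      (by fun_prop) (fun s => by simpa using (hasDerivAt_id s).const_mul c)
      (fun s => hasDerivAt_const s c) p
    rw [zero_mul, add_zero] at h
    exact h
  have hgrad_smul : ∀ (c : ℝ) (q a : F → ℝ), ContMDiff (𝓡 n) 𝓘(ℝ, ℝ) ∞ a → ∀ p,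
      gradInner g q (c • a) p = c * gradInner g q a p := fun c q a ha p =>
    gradInner_scomp_right g (ψ := fun s => c * s) (ψ' := fun _ => c) q ha
      (fun s => by simpa using (hasDerivAt_id s).const_mul c) p
  have hex : ∃ δ : F → ℝ, ContMDiff (𝓡 n) 𝓘(ℝ, ℝ) ∞ δ ∧ (∀ p, 0 < δ p) ∧ ∀ p, D δ p ≤ ε p := by
    refine exists_small_smooth_pos (n := n) D ε ?_ ?_ ?_ ?_ ?_
    · intro a b ha hb p
      simp only [hD, Pi.add_apply]
      rw [laplacian_add g ha hb, gradInner_add_right g _ ha hb, gradInner_add_right g _ ha hb]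
      have h1 := abs_add_le (a p) (b p)
      have h2 := abs_add_le (laplacian g a p) (laplacian g b p)
      have h3 : 2 * |gradInner g f a p + gradInner g f b p| / f p
          ≤ 2 * |gradInner g f a p| / f p + 2 * |gradInner g f b p| / f p := by
        rw [← add_div, ← mul_add]
        have := (hfpos p).le
        gcongr
        exact abs_add_le _ _
      have h4 := abs_add_le (gradInner g r a p) (gradInner g r b p)
      linarith
    · intro c a hc ha p
      simp only [hD, Pi.smul_apply, smul_eq_mul]
      rw [hlap_smul c a ha, hgrad_smul c _ a ha, hgrad_smul c _ a ha, abs_mul, abs_mul, abs_mul,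
        abs_mul, abs_of_nonneg hc]
      apply le_of_eq
      ring
    · intro a b p h
      simp only [hD]
      rw [laplacian_congr g h, gradInner_congr_right g _ h, gradInner_congr_right g _ h,
        h.self_of_nhds]
    · intro a ha p
      have hc : Continuous (D a) := by
        have h1 := continuous_laplacian g ha
        have h2 := continuous_gradInner g hf ha
        have h3 := continuous_gradInner g hr ha
        have h4 := ha.continuous
        have h5 := hf.continuous
        exact h4.abs.add ((h1.abs.add ((continuous_const.mul h2.abs).div h5
          fun p => (hfpos p).ne')).add (continuous_const.mul h3.abs))
      exact ⟨D a p + 1, (hc.continuousAt.eventually (gt_mem_nhds (lt_add_one _))).mono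
        fun x hx => le_of_lt hx⟩
    · intro p
      obtain ⟨c, hc, h⟩ := exists_lower_bound_ite hC (continuous_gradInner g hr hr) hCr p
      obtain ⟨c', hc', h'⟩ := exists_lower_bound_ite hA (hr.continuous.abs.div_const 2)
        (fun p hp => half_pos (abs_pos.2 (hAr p hp))) p
      refine ⟨min (1 / 2) (min c c'), by positivity, ?_⟩
      filter_upwards [h, h'] with x hx hx'
      exact min_le_min_left _ (min_le_min hx hx')
  obtain ⟨δ, hδs, hδpos, hδ⟩ := hex
  have hnn : ∀ p, 0 ≤ |laplacian g δ p| + 2 * |gradInner g f δ p| / f p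
      + 2 * |gradInner g r δ p| := fun p => by
    have := hfpos p
    positivity
  have hle : ∀ p, δ p ≤ ε p := fun p =>
    (le_abs_self _).trans ((le_add_of_nonneg_right (hnn p)).trans (hδ p))
  refine ⟨δ, hδs, hδpos, fun p => ?_, fun p hp => ?_, fun p hp => ?_⟩
  · exact ((hle p).trans (min_le_left _ _)).trans_lt (by norm_num)
  · have h := (hle p).trans ((min_le_right _ _).trans (min_le_right _ _))
    rw [if_pos hp] at h
    exact h.trans_lt (half_lt_self (abs_pos.2 (hAr p hp)))
  · have h := (hδ p).trans ((min_le_right _ _).trans (min_le_left _ _))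
    rw [if_pos hp] at h
    exact (le_add_of_nonneg_left (abs_nonneg _)).trans h

/-- The gluing of two functions along a hypersurface, in terms of the relative difference `r`. -/
theorem exists_glued [T2Space F] [SecondCountableTopology F] (g : SmoothMetric n F)
    {f r : F → ℝ} (hf : ContMDiff (𝓡 n) 𝓘(ℝ, ℝ) ∞ f) (hr : ContMDiff (𝓡 n) 𝓘(ℝ, ℝ) ∞ r)
    (hfpos : ∀ p, 0 < f p) (hfrpos : ∀ p, 0 < f p + f p * r p)
    (hL : ∀ p, 0 < conformalLaplacian g f p) (hL' : ∀ p, 0 < conformalLaplacian g (f + f * r) p)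
    {N P M W : Set F} (hP : IsOpen P) (hM : IsOpen M) (hdisj : Disjoint P M) (hsep : P ∪ M = Nᶜ)
    (hW : IsOpen W) (hNW : N ⊆ W) (hWr : ∀ p ∈ W, 0 < gradInner g r r p)
    (hWP : ∀ p ∈ W ∩ P, 0 < r p) (hWM : ∀ p ∈ W ∩ M, r p < 0) :
    ∃ h : F → ℝ, ContMDiff (𝓡 n) 𝓘(ℝ, ℝ) ∞ h ∧ (∀ p, 0 < h p) ∧
      (∀ p, 0 < conformalLaplacian g h p) ∧ (∀ p ∈ P \ W, h p = f p) ∧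
      (∀ p ∈ M \ W, h p = f p + f p * r p) := by
  classical
  have : LocallyCompactSpace F := ChartedSpace.locallyCompactSpace (EuclideanSpace ℝ (Fin n)) F
  have hN : IsClosed N := by
    rw [← isOpen_compl_iff, ← hsep]
    exact hP.union hM
  -- The rounding takes place on `V`. On the collar `closure V \ V'`, requiring `δ < |r|` forces
  -- `|s| > 1`, so the rounded function already equals one of the two given ones before `V` ends.
  obtain ⟨V, hV, hNV, hVW⟩ := normal_exists_closure_subset hN hW hNW
  obtain ⟨V', hV', hNV', hVV'⟩ := normal_exists_closure_subset hN hV hNV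
  have hside : ∀ p, p ∉ N → p ∈ P ∨ p ∈ M := fun p hp => by
    have h : p ∈ P ∪ M := hsep ▸ hp
    exact h
  obtain ⟨δ, hδs, hδ0, hδ1, hδA, hδC⟩ := exists_gluing_width g hf hr hfpos
    (A := closure V \ V') (C := closure V) (isClosed_closure.sdiff hV') isClosed_closure
    (fun p hp => by
      rcases hside p fun h => hp.2 (hNV' h) with h | h
      · exact (hWP p ⟨hVW hp.1, h⟩).ne'
      · exact (hWM p ⟨hVW hp.1, h⟩).ne) fun p hp => hWr p (hVW hp)
  obtain ⟨η, w, b, hη, hηw, hwb, hw0, -, hb1, hZ0, hZb, hZw, hη1, hηm1⟩ :=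
    exists_smooth_concave_min
  set s : F → ℝ := fun p => r p / δ p with hs_def
  have hs : ContMDiff (𝓡 n) 𝓘(ℝ, ℝ) ∞ s := hr.div₀ hδs fun p => (hδ0 p).ne'
  have hδsr : δ * s = r := funext fun p => mul_div_cancel₀ _ (hδ0 p).ne'
  set h₀ : F → ℝ := f + f * δ * (η ∘ s) with hh₀
  have hh₀s : ContMDiff (𝓡 n) 𝓘(ℝ, ℝ) ∞ h₀ := hf.add ((hf.mul hδs).mul (hη.contMDiff.comp hs))
  have hfr : f + f * δ * s = f + f * r := by rw [mul_assoc, hδsr]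
  have hlarge : ∀ p, 1 ≤ s p → h₀ p = f p := fun p hp => by
    simp [hh₀, hη1 _ hp]
  have hlow : ∀ p, s p ≤ -1 → h₀ p = f p + f p * r p := fun p hp => by
    have h1 := congrFun hfr p
    simp only [Pi.add_apply, Pi.mul_apply] at h1
    simp [hh₀, hηm1 _ hp, h1]
  have hηmono : Monotone η := monotone_of_hasDerivAt_nonneg hηw hw0
  have hh₀pos : ∀ p, 0 < h₀ p := fun p => by
    rcases le_total (s p) (-1) with hp | hp
    · rw [hlow p hp]
      exact hfrpos p
    · have h1 : -1 ≤ η (s p) := (hηm1 (-1) le_rfl).symm.le.trans (hηmono hp)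
      have h2 : h₀ p = f p * (1 + δ p * η (s p)) := by
        simp only [hh₀, Pi.add_apply, Pi.mul_apply, Function.comp]
        ring
      rw [h2]
      exact mul_pos (hfpos p) (by nlinarith [hδ0 p, hδ1 p])
  have hh₀L : ∀ p ∈ closure V, 0 < conformalLaplacian g h₀ p := fun p hp =>
    conformalLaplacian_glue_pos g hf hδs hs hη hηw hwb hw0 hb1 hZ0 hZb hZw (hfpos p) (hδ0 p)
      (hδ1 p) (hL p) (by rw [hfr]; exact hL' p) (by rw [hδsr]; exact hδC p hp)
  set h : F → ℝ := fun p => if p ∈ V then h₀ p else if p ∈ P then f p else f p + f p * r p with hh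
  -- Smoothness and positivity of `L h` are local: near each point `h` is one of three globally
  -- smooth functions.
  have hcase : ∀ p, (p ∈ V ∧ h =ᶠ[𝓝 p] h₀) ∨ h =ᶠ[𝓝 p] f ∨ h =ᶠ[𝓝 p] f + f * r := fun p => by
    by_cases hp : p ∈ V
    · refine Or.inl ⟨hp, ?_⟩
      filter_upwards [hV.mem_nhds hp] with q hq
      simp [hh, hq]
    have hpV' : p ∈ (closure V')ᶜ := fun h => hp (hVV' h)
    have hopen : IsOpen (closure V')ᶜ := isClosed_closure.isOpen_compl
    rcases hside p fun h => hp (hNV h) with hpP | hpM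
    · refine Or.inr (Or.inl ?_)
      filter_upwards [hP.mem_nhds hpP, hopen.mem_nhds hpV'] with q hqP hqV'
      by_cases hq : q ∈ V
      · have hqA := hδA q ⟨subset_closure hq, fun h => hqV' (subset_closure h)⟩
        rw [abs_of_pos (hWP q ⟨hVW (subset_closure hq), hqP⟩)] at hqA
        simp only [hh, if_pos hq]
        exact hlarge q ((one_le_div (hδ0 q)).2 hqA.le)
      · simp [hh, hq, hqP]
    · refine Or.inr (Or.inr ?_)
      filter_upwards [hM.mem_nhds hpM, hopen.mem_nhds hpV'] with q hqM hqV'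
      by_cases hq : q ∈ V
      · have hqA := hδA q ⟨subset_closure hq, fun h => hqV' (subset_closure h)⟩
        rw [abs_of_neg (hWM q ⟨hVW (subset_closure hq), hqM⟩)] at hqA
        simp only [hh, if_pos hq]
        refine hlow q ?_
        rw [hs_def]
        simp only
        rw [div_le_iff₀ (hδ0 q)]
        linarith
      · have hqP : q ∉ P := fun h => disjoint_left.1 hdisj h hqM
        simp [hh, hq, hqP]
  refine ⟨h, fun p => ?_, fun p => ?_, fun p => ?_, fun p hp => ?_, fun p hp => ?_⟩
  · rcases hcase p with ⟨-, hc⟩ | hc | hc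
    · exact (hh₀s p).congr_of_eventuallyEq hc
    · exact (hf p).congr_of_eventuallyEq hc
    · exact ((hf.add (hf.mul hr)) p).congr_of_eventuallyEq hc
  · rcases hcase p with ⟨-, hc⟩ | hc | hc
    · exact hc.self_of_nhds ▸ hh₀pos p
    · exact hc.self_of_nhds ▸ hfpos p
    · exact hc.self_of_nhds ▸ hfrpos p
  · rcases hcase p with ⟨hp, hc⟩ | hc | hc
    · rw [conformalLaplacian_congr g hc]
      exact hh₀L p (subset_closure hp)
    · rw [conformalLaplacian_congr g hc]
      exact hL p
    · rw [conformalLaplacian_congr g hc]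
      exact hL' p
  · have hpV : p ∉ V := fun h => hp.2 (hVW (subset_closure h))
    simp [hh, hpV, hp.1]
  · have hpV : p ∉ V := fun h => hp.2 (hVW (subset_closure h))
    have hpP : p ∉ P := fun h => disjoint_left.1 hdisj h hp.1
    simp [hh, hpV, hpP]

end Main

end ConformalSmoothing

end

/-! ### The theorem: reduction to the relative difference `r`. -/

theorem mainTheorem8 (n : ℕ) (hn : 2 ≤ n)
    {F : Type*} [TopologicalSpace F] [T2Space F] [SecondCountableTopology F]
    [ChartedSpace (EuclideanSpace ℝ (Fin n)) F] [IsManifold (𝓡 n) ∞ F]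
    (g : ConformalSmoothing.SmoothMetric n F)
    {N : Type*} [TopologicalSpace N]
    [ChartedSpace (EuclideanSpace ℝ (Fin (n - 1))) N] [IsManifold (𝓡 (n - 1)) ∞ N]
    (ι : N → F) (hι : Manifold.IsSmoothEmbedding (𝓡 (n - 1)) (𝓡 n) ∞ ι)
    -- the unit normal of the hypersurface `ι(N)`, which separates `F` into the sides `P`, `M`
    (ν : ∀ x : N, TangentSpace (𝓡 n) (ι x))
    (hν : ∀ x, ConformalSmoothing.IsUnitNormal g ι x (ν x))
    (P M : Set F) (hP : IsOpen P) (hM : IsOpen M) (hdisj : Disjoint P M)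
    (hsep : P ∪ M = (range ι)ᶜ)
    (hνP : ∀ x, ConformalSmoothing.PointsInto (ι x) (ν x) P)
    (hνM : ∀ x, ConformalSmoothing.PointsInto (ι x) (-ν x) M)
    (f₁ f₂ : F → ℝ)
    (hf₁ : ContMDiff (𝓡 n) 𝓘(ℝ, ℝ) ∞ f₁) (hf₂ : ContMDiff (𝓡 n) 𝓘(ℝ, ℝ) ∞ f₂)
    (hpos₁ : ∀ p, 0 < f₁ p) (hpos₂ : ∀ p, 0 < f₂ p)
    (hL₁ : ∀ p, 0 < ConformalSmoothing.conformalLaplacian g f₁ p)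
    (hL₂ : ∀ p, 0 < ConformalSmoothing.conformalLaplacian g f₂ p)
    (heq : ∀ x, f₁ (ι x) = f₂ (ι x))
    (hnormal : ∀ x, ConformalSmoothing.dirDeriv f₂ (ι x) (ν x) <
      ConformalSmoothing.dirDeriv f₁ (ι x) (ν x)) :
    -- near the hypersurface, `f₂` is the smaller function on the side `P`, and `f₁` on `M`
    (∀ x, (∀ᶠ q in 𝓝[P] (ι x), f₂ q < f₁ q) ∧ (∀ᶠ q in 𝓝[M] (ι x), f₁ q < f₂ q)) ∧
    ∀ E ∈ 𝓝ˢ (range ι), ∃ fE : F → ℝ,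
      ContMDiff (𝓡 n) 𝓘(ℝ, ℝ) ∞ fE ∧
      (∀ p, 0 < fE p) ∧
      (∀ p, 0 < ConformalSmoothing.conformalLaplacian g fE p) ∧
      (∀ p ∈ P \ E, fE p = f₂ p) ∧
      (∀ p ∈ M \ E, fE p = f₁ p) := by
  set r : F → ℝ := fun p => f₁ p / f₂ p - 1 with hr_def
  have hr : ContMDiff (𝓡 n) 𝓘(ℝ, ℝ) ∞ r :=
    (hf₁.div₀ hf₂ fun p => (hpos₂ p).ne').sub contMDiff_const
  have hf₁r : f₁ = f₂ + f₂ * r := by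
    funext p
    have := (hpos₂ p).ne'
    simp only [hr_def, Pi.add_apply, Pi.mul_apply]
    field_simp
    ring
  have hrpos : ∀ p, 0 < r p ↔ f₂ p < f₁ p := fun p => by
    rw [hr_def, sub_pos, one_lt_div (hpos₂ p)]
  have hrneg : ∀ p, r p < 0 ↔ f₁ p < f₂ p := fun p => by
    rw [hr_def, sub_neg, div_lt_one (hpos₂ p)]
  have hr0 : ∀ x, r (ι x) = 0 := fun x => by
    simp only [hr_def, heq, div_self (hpos₂ _).ne', sub_self]
  have hrν : ∀ x, 0 < ConformalSmoothing.dirDeriv r (ι x) (ν x) := fun x => by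
    have h := hnormal x
    -- As `r = 0` on the hypersurface, the product rule leaves `∂f₁ = ∂f₂ + f₂ ∂r` there.
    rw [hf₁r, ConformalSmoothing.dirDeriv_add hf₂ (hf₂.mul hr),
      ConformalSmoothing.dirDeriv_mul hf₂ hr, hr0, zero_mul, add_zero] at h
    exact pos_of_mul_pos_right (lt_add_iff_pos_right _ |>.1 h) (hpos₂ _).le
  have hzero : ∀ q, q ∉ P ∪ M → r q = 0 := fun q hq => by
    rw [hsep, notMem_compl_iff] at hq
    obtain ⟨x, rfl⟩ := hq
    exact hr0 x
  have hsign : ∀ x, ∃ U ∈ 𝓝 (ι x), (∀ q ∈ U ∩ P, 0 < r q) ∧ (∀ q ∈ U ∩ M, r q < 0) := fun x =>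
    ConformalSmoothing.exists_nhds_sign_of_pointsInto hr (hrν x) (hr0 x) hP hM hdisj hzero
      (hνP x) (hνM x)
  choose U hU hUP hUM using hsign
  refine ⟨fun x => ⟨?_, ?_⟩, fun E hE => ?_⟩
  · filter_upwards [mem_nhdsWithin_of_mem_nhds (hU x), self_mem_nhdsWithin] with q hq hqP
    exact (hrpos q).1 (hUP x q ⟨hq, hqP⟩)
  · filter_upwards [mem_nhdsWithin_of_mem_nhds (hU x), self_mem_nhdsWithin] with q hq hqM
    exact (hrneg q).1 (hUM x q ⟨hq, hqM⟩)
  -- An open neighbourhood of the hypersurface inside `E` where `∇r ≠ 0` and the sign of `r` matches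
  -- the side.
  set W : Set F := interior E ∩ {p | 0 < ConformalSmoothing.gradInner g r r p} ∩
    ⋃ x, interior (U x) with hW
  have hNW : range ι ⊆ W := by
    rintro _ ⟨x, rfl⟩
    refine ⟨⟨?_, ConformalSmoothing.gradInner_self_pos g hr (hrν x).ne'⟩, mem_iUnion.2
      ⟨x, mem_interior_iff_mem_nhds.2 (hU x)⟩⟩
    exact subset_interior_iff_mem_nhdsSet.2 hE (mem_range_self x)
  have hWP : ∀ p ∈ W ∩ P, 0 < r p := by
    rintro p ⟨hp, hpP⟩
    obtain ⟨x, hx⟩ := mem_iUnion.1 hp.2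
    exact hUP x p ⟨interior_subset hx, hpP⟩
  have hWM : ∀ p ∈ W ∩ M, r p < 0 := by
    rintro p ⟨hp, hpM⟩
    obtain ⟨x, hx⟩ := mem_iUnion.1 hp.2
    exact hUM x p ⟨interior_subset hx, hpM⟩
  have hWo : IsOpen W := (isOpen_interior.inter (isOpen_lt continuous_const
    (ConformalSmoothing.continuous_gradInner g hr hr))).inter
    (isOpen_iUnion fun x => isOpen_interior)
  have hpos₁' : ∀ p, 0 < f₂ p + f₂ p * r p := fun p => by
    have h : f₁ p = f₂ p + f₂ p * r p := congrFun hf₁r p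
    exact h ▸ hpos₁ p
  obtain ⟨fE, h1, h2, h3, h4, h5⟩ := ConformalSmoothing.exists_glued g hf₂ hr hpos₂ hpos₁' hL₂
    (by rwa [← hf₁r]) hP hM hdisj hsep hWo hNW (fun p hp => hp.1.2) hWP hWM
  have hWE : W ⊆ E := fun p hp => interior_subset hp.1.1
  refine ⟨fE, h1, h2, h3, fun p hp => h4 p ⟨hp.1, fun h => hp.2 (hWE h)⟩, fun p hp => ?_⟩
  rw [h5 p ⟨hp.1, fun h => hp.2 (hWE h)⟩, hf₁r]
  rfl
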